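/- **Setting.** Let $\mathcal G$ be a connected undirected graph on a finite set of $m$ agents. Agent $i$ has a closed convex set $X^{(i)}\subseteq\mathbb R^d$ and an objective $f_i=\tilde f_i+\mu\nu_i$, where $\mu\ge 0$, $\tilde f_i:\mathbb R^d\to\mathbb R$ is convex and differentiable with $\tilde L$-Lipschitz gradient, and $\nu_i$ is lower semicontinuous and $1$-strongly convex on $X^{(i)}$, all with respect to the Euclidean norm. Put $\mathcal X=\prod_i X^{(i)}$, $f(x)=\sum_i f_i(x^{(i)})$ and $\mathcal A=M\otimes I_d$, where $M$ is a real matrix with $Mw=0$ if and only if $w_i=w_j$ for all adjacent $i,j$ (for example the graph Laplacian, or the transpose of an oriented incidence matrix). Let $(x^*,z^*)$ be a saddle point of $f(x)+\langle\mathcal Ax,z\rangle$ over $x\in\mathcal X$ and all $z$. Norms are Euclidean, and $\|\mathcal A\|$ is the corresponding operator norm. **Oracle.** For every $x^{(i)}$ in a set $D_i\supseteq X^{(i)}$ that almost surely contains all points $\underline x_k^{(i)}$ queried below (for example $D_i=\mathbb R^d$), the oracle returns $G_i(x^{(i)},\xi^{(i)})$ with $\mathbb E[G_i(x^{(i)},\xi^{(i)})]=\nabla\tilde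 f_i(x^{(i)})$, and the stacked estimator satisfies $\sum_i\mathbb E\|G_i(x^{(i)},\xi^{(i)})-\nabla\tilde f_i(x^{(i)})\|_2^2\le\sigma^2$ whenever $x^{(i)}\in D_i$ for all $i$. The network-wide samples $(\xi_k^{(i),j})_i$ are independent over all $(k,j)$. **Algorithm (SPDS).** Let $N\ge 1$; for $1\le k\le N$ let $T_k,c_k\ge 1$ be integers and $\beta_k,p_k>0$, and let $q_k^t>0$ for $1\le t\le T_k$; let $\tau_k,\lambda_k,\alpha_k^t,\eta_k^t$ be real. Choose $x_0,\underline x_0\in\mathcal X$ and set $\hat x_0=x_{-1}=x_0$, $z_0=0$. For $k=1,\dots,N$ put $$\tilde x_k=x_{k-1}+\lambda_k(\hat x_{k-1}-x_{k-2}),\qquad \underline x_k=\frac{\tilde x_k+\tau_k\underline x_{k-1}}{1+\tau_k},\qquad v_k^{(i)}=\frac1{c_k}\sum_{j=1}^{c_k}G_i(\underline x_k^{(i)},\xi_k^{(i),j}),$$ $x_k^0=x_{k-1}$, $z_k^0=z_{k-1}$, $x_1^{-1}=x_0$, and $x_k^{-1}=x_{k-1}^{T_{k-1}-1}$ for $k\ge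 2$. For $t=1,\dots,T_k$ put $\tilde u_k^t=x_k^{t-1}+\alpha_k^t(x_k^{t-1}-x_k^{t-2})$ and $$z_k^t=\operatorname*{argmin}_{z}\ \langle-\mathcal A\tilde u_k^t,z\rangle+\tfrac{q_k^t}2\|z-z_k^{t-1}\|_2^2,$$ $$x_k^t=\operatorname*{argmin}_{x\in\mathcal X}\ \mu\sum_i\nu_i(x^{(i)})+\langle v_k+\mathcal A^\top z_k^t,x\rangle+\tfrac{\eta_k^t}2\|x_k^{t-1}-x\|_2^2+\tfrac{p_k}2\|x_{k-1}-x\|_2^2,$$ where both minimizations are carried out block by block. Then set $x_k=x_k^{T_k}$, $z_k=z_k^{T_k}$ and $\hat x_k=\frac1{T_k}\sum_{t=1}^{T_k}x_k^t$. The output is $\overline x_N=\big(\sum_{k=1}^N\beta_k\big)^{-1}\sum_{k=1}^N\beta_k\hat x_k$. **Proposition.** Suppose that * for $2\le k\le N$: $\beta_k\tau_k\le\beta_{k-1}(\tau_{k-1}+1)$, $\ \beta_{k-1}=\beta_k\lambda_k$, $\ 2\tilde L\lambda_k\le p_{k-1}\tau_k$, $\ \beta_kT_{k-1}\alpha_k^1=\beta_{k-1}T_k$,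 $\ \alpha_k^1\|\mathcal A\|^2\le\eta_{k-1}^{T_{k-1}}q_k^1$, $\ \beta_kT_{k-1}q_k^1\le\beta_{k-1}T_kq_{k-1}^{T_{k-1}}$, $\ \beta_kT_{k-1}(\eta_k^1+p_kT_k)\le\beta_{k-1}T_k(\mu+\eta_{k-1}^{T_{k-1}}+p_{k-1})$; * for $1\le k\le N$ and $2\le t\le T_k$: $\alpha_k^t=1$, $\ \|\mathcal A\|^2\le\eta_k^{t-1}q_k^t$, $\ q_k^t\le q_k^{t-1}$, $\ \eta_k^t\le\mu+\eta_k^{t-1}+p_k$; * $\tau_1=0$, $\ p_N(\tau_N+1)\ge 2\tilde L$, $\ \eta_N^{T_N}q_N^{T_N}\ge\|\mathcal A\|^2$. Then $f(\overline x_N)-f(x^*)$ and $\|\mathcal A\overline x_N\|_2$ are integrable and $$\mathbb E[f(\overline x_N)-f(x^*)]\le\Big(\sum_{k=1}^N\beta_k\Big)^{-1}\Big[\tfrac{\beta_1}2\Big(\tfrac{\eta_1^1}{T_1}+p_1\Big)\|x_0-x^*\|_2^2+\sum_{k=1}^N\tfrac{\beta_k\sigma^2}{p_kc_k}\Big],$$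 $$\mathbb E[\|\mathcal A\overline x_N\|_2]\le\Big(\sum_{k=1}^N\beta_k\Big)^{-1}\Big[\tfrac{\beta_1q_1^1}{2T_1}(\|z^*\|_2+1)^2+\tfrac{\beta_1}2\Big(\tfrac{\eta_1^1}{T_1}+p_1\Big)\|x_0-x^*\|_2^2+\sum_{k=1}^N\tfrac{\beta_k\sigma^2}{p_kc_k}\Big].$$ -/

import Mathlib

open MeasureTheory ProbabilityTheory
open scoped NNReal

namespace SPDS

noncomputable section

/-- Stacked vectors `(x i)_{i : ι}` with blocks `x i ∈ ℝᵈ`, with the Euclidean norm of `ℝ^(|ι| d)`. -/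
abbrev Stack (ι : Type*) (d : ℕ) : Type _ :=
  PiLp 2 (fun _ : ι => EuclideanSpace ℝ (Fin d))

/-- The operator `M ⊗ I_d` as a linear map, acting blockwise by
`((M ⊗ I_d) x) e = ∑ v, M e v • x v`. -/
def blockLin {κ V : Type*} [Fintype V] (d : ℕ) (M : Matrix κ V ℝ) :
    Stack V d →ₗ[ℝ] Stack κ d where
  toFun x := WithLp.toLp 2 (fun e => ∑ v, M e v • x v)
  map_add' x y := by
    ext1 e
    simp [smul_add, Finset.sum_add_distrib]
  map_smul' r x := by
    ext1 e
    simp [Finset.smul_sum, smul_comm r]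

/-- The operator `M ⊗ I_d` as a continuous linear map; `‖blockOp d M‖` is its operator norm with
respect to the Euclidean norms. -/
def blockOp {κ V : Type*} [Fintype κ] [Fintype V] (d : ℕ) (M : Matrix κ V ℝ) :
    Stack V d →L[ℝ] Stack κ d :=
  { blockLin d M with
    cont := by
      refine (PiLp.continuous_toLp 2 _).comp (continuous_pi fun e => ?_)
      exact continuous_finsetSum _ fun v _ => (PiLp.continuous_apply 2 _ v).const_smul (M e v) }

theorem blockOp_apply {κ V : Type*} [Fintype κ] [Fintype V] (d : ℕ) (M : Matrix κ V ℝ)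
    (x : Stack V d) (e : κ) : blockOp d M x e = ∑ v, M e v • x v := rfl

/-- `M` encodes the consensus constraints of the network `G`: `M w = 0` exactly when `w` takes
equal values at any two agents joined by a communication edge. -/
def EnforcesConsensus {κ V : Type*} [Fintype V] (G : SimpleGraph V) (M : Matrix κ V ℝ) : Prop :=
  ∀ w : V → ℝ, M.mulVec w = 0 ↔ ∀ i j, G.Adj i j → w i = w j

/-- The graph Laplacian is an admissible choice. -/
theorem enforcesConsensus_lapMatrix {V : Type*} [Fintype V] [DecidableEq V] (G : SimpleGraph V)
    [DecidableRel G.Adj] : EnforcesConsensus G (G.lapMatrix ℝ) := fun _ =>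
  G.lapMatrix_mulVec_eq_zero_iff_forall_adj

/-- The transpose of an oriented incidence matrix is an admissible choice: the edges of `G` are
listed by `κ`, the edge `e` being oriented from `tail e` to `head e`. -/
theorem enforcesConsensus_incidence_transpose {κ V : Type*} [Fintype V] [DecidableEq V]
    (G : SimpleGraph V) (tail head : κ → V)
    (hG : ∀ i j, G.Adj i j ↔ ∃ e, s(tail e, head e) = s(i, j)) :
    EnforcesConsensus G (Matrix.of fun e v =>
      ((if v = head e then 1 else 0) - (if v = tail e then 1 else 0) : ℝ)) := by
  intro w
  have key : ∀ e, (Matrix.of fun e v =>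
      ((if v = head e then 1 else 0) - (if v = tail e then 1 else 0) : ℝ)).mulVec w e =
      w (head e) - w (tail e) := by
    intro e
    simp [Matrix.mulVec, dotProduct, sub_mul, Finset.sum_sub_distrib]
  constructor
  · intro h i j hij
    obtain ⟨e, he⟩ := (hG i j).1 hij
    have h1 := congrFun h e
    rw [key e] at h1
    simp only [Pi.zero_apply] at h1
    rcases Sym2.eq_iff.1 he with ⟨rfl, rfl⟩ | ⟨rfl, rfl⟩ <;> linarith
  · intro h
    funext e
    rw [key e, h _ _ ((hG (tail e) (head e)).2 ⟨e, rfl⟩)]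
    simp

/-- The local data of the agents: constraint sets `X i`, and local objectives
`f i = fs i + μ ν i`, with `fs i` convex and `L`-smooth and with `ν i` strongly convex with
modulus `1` (and closed), all with respect to the Euclidean norm. -/
structure LocalData (V : Type*) (d : ℕ) where
  X : V → Set (EuclideanSpace ℝ (Fin d))
  fs : V → EuclideanSpace ℝ (Fin d) → ℝ
  ν : V → EuclideanSpace ℝ (Fin d) → ℝ
  μ : ℝ
  L : ℝ≥0
  isClosed_X : ∀ i, IsClosed (X i)
  convex_X : ∀ i, Convex ℝ (X i)
  convexOn_fs : ∀ i, ConvexOn ℝ Set.univ (fs i)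
  differentiable_fs : ∀ i, Differentiable ℝ (fs i)
  lipschitz_gradient_fs : ∀ i, LipschitzWith L (gradient (fs i))
  μ_nonneg : 0 ≤ μ
  strongConvexOn_ν : ∀ i, StrongConvexOn (X i) 1 (ν i)
  lowerSemicontinuousOn_ν : ∀ i, LowerSemicontinuousOn (ν i) (X i)

namespace LocalData

variable {V : Type*} {d : ℕ} (P : LocalData V d)

/-- The product set `𝒳` of the local constraint sets. -/
def feasible : Set (Stack V d) := {x | ∀ i, x i ∈ P.X i}

/-- The overall objective `f x = ∑ i, (fs i (x i) + μ ν i (x i))`. -/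
def objective [Fintype V] (x : Stack V d) : ℝ :=
  ∑ i, (P.fs i (x i) + P.μ * P.ν i (x i))

end LocalData

/-- A stochastic first-order oracle. Agent `i` may query `G i` at the points of
`queryDomain i`, a set containing `X i`. On these points the estimators are unbiased, and the
stacked estimator `(G i (x i) ·)_i` has variance at most `σ ^ 2`. -/
structure Oracle {V : Type*} [Fintype V] {d : ℕ} (P : LocalData V d) (Ξ : V → Type*)
    [∀ i, MeasurableSpace (Ξ i)] (σ : ℝ) where
  law : ∀ i, Measure (Ξ i)
  isProbabilityMeasure_law : ∀ i, IsProbabilityMeasure (law i)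
  queryDomain : V → Set (EuclideanSpace ℝ (Fin d))
  subset_queryDomain : ∀ i, P.X i ⊆ queryDomain i
  G : ∀ i, EuclideanSpace ℝ (Fin d) → Ξ i → EuclideanSpace ℝ (Fin d)
  measurable_G : ∀ i, Measurable (Function.uncurry (G i))
  unbiased : ∀ i, ∀ x ∈ queryDomain i,
    Integrable (G i x) (law i) ∧ ∫ s, G i x s ∂(law i) = gradient (P.fs i) x
  integrable_sq : ∀ i, ∀ x ∈ queryDomain i,
    Integrable (fun s => ‖G i x s - gradient (P.fs i) x‖ ^ 2) (law i)
  variance_le : ∀ x : Stack V d, (∀ i, x i ∈ queryDomain i) →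
    ∑ i, ∫ s, ‖G i (x i) s - gradient (P.fs i) (x i)‖ ^ 2 ∂(law i) ≤ σ ^ 2

/-- The mini-batch estimator `v_k` at a query point `y`: agent `i` averages its estimators over
the `c` samples `ξ j i`, `j = 1, …, c`. -/
def Oracle.miniBatch {V : Type*} [Fintype V] {d : ℕ} {P : LocalData V d} {Ξ : V → Type*}
    [∀ i, MeasurableSpace (Ξ i)] {σ : ℝ} (O : Oracle P Ξ σ) (c : ℕ) (ξ : ℕ → ∀ i, Ξ i)
    (y : Stack V d) : Stack V d :=
  WithLp.toLp 2 (fun i => (1 / (c : ℝ)) • ∑ j ∈ Finset.Icc 1 c, O.G i (y i) (ξ j i))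

/-- The parameters of the algorithm: outer index `k = 1, …, N`, inner index `t = 1, …, T k`. -/
structure Params where
  N : ℕ
  T : ℕ → ℕ
  c : ℕ → ℕ
  β : ℕ → ℝ
  τ : ℕ → ℝ
  lam : ℕ → ℝ
  p : ℕ → ℝ
  α : ℕ → ℕ → ℝ
  η : ℕ → ℕ → ℝ
  q : ℕ → ℕ → ℝ

/-- The parameters make sense: there is at least one iteration, the batch sizes and inner
iteration limits are positive, and so are the weights `β` and the prox parameters `p` and `q`. -/
structure Params.Admissible (a : Params) : Prop where
  one_le_N : 1 ≤ a.N
  one_le_T : ∀ k, 1 ≤ k → k ≤ a.N → 1 ≤ a.T k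
  one_le_c : ∀ k, 1 ≤ k → k ≤ a.N → 1 ≤ a.c k
  β_pos : ∀ k, 1 ≤ k → k ≤ a.N → 0 < a.β k
  p_pos : ∀ k, 1 ≤ k → k ≤ a.N → 0 < a.p k
  q_pos : ∀ k, 1 ≤ k → k ≤ a.N → ∀ t, 1 ≤ t → t ≤ a.T k → 0 < a.q k t

/-- The parameter conditions, where `μ` is the strong convexity modulus, `L` the Lipschitz
constant, and `nA` the norm of the constraint operator. -/
structure Params.Conditions (a : Params) (μ L nA : ℝ) : Prop where
  β_mul_τ_le : ∀ k, 2 ≤ k → k ≤ a.N → a.β k * a.τ k ≤ a.β (k - 1) * (a.τ (k - 1) + 1)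
  β_eq : ∀ k, 2 ≤ k → k ≤ a.N → a.β (k - 1) = a.β k * a.lam k
  L_mul_lam_le : ∀ k, 2 ≤ k → k ≤ a.N → 2 * L * a.lam k ≤ a.p (k - 1) * a.τ k
  α_one_eq : ∀ k, 2 ≤ k → k ≤ a.N → a.β k * a.T (k - 1) * a.α k 1 = a.β (k - 1) * a.T k
  α_one_mul_le : ∀ k, 2 ≤ k → k ≤ a.N →
    a.α k 1 * nA ^ 2 ≤ a.η (k - 1) (a.T (k - 1)) * a.q k 1
  q_one_le : ∀ k, 2 ≤ k → k ≤ a.N →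
    a.β k * a.T (k - 1) * a.q k 1 ≤ a.β (k - 1) * a.T k * a.q (k - 1) (a.T (k - 1))
  η_one_le : ∀ k, 2 ≤ k → k ≤ a.N →
    a.β k * a.T (k - 1) * (a.η k 1 + a.p k * a.T k) ≤
      a.β (k - 1) * a.T k * (μ + a.η (k - 1) (a.T (k - 1)) + a.p (k - 1))
  α_eq_one : ∀ k, 1 ≤ k → k ≤ a.N → ∀ t, 2 ≤ t → t ≤ a.T k → a.α k t = 1
  nA_sq_le : ∀ k, 1 ≤ k → k ≤ a.N → ∀ t, 2 ≤ t → t ≤ a.T k → nA ^ 2 ≤ a.η k (t - 1) * a.q k t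
  q_anti : ∀ k, 1 ≤ k → k ≤ a.N → ∀ t, 2 ≤ t → t ≤ a.T k → a.q k t ≤ a.q k (t - 1)
  η_le : ∀ k, 1 ≤ k → k ≤ a.N → ∀ t, 2 ≤ t → t ≤ a.T k → a.η k t ≤ μ + a.η k (t - 1) + a.p k
  τ_one : a.τ 1 = 0
  L_le_last : 2 * L ≤ a.p a.N * (a.τ a.N + 1)
  nA_sq_le_last : nA ^ 2 ≤ a.η a.N (a.T a.N) * a.q a.N (a.T a.N)

/-- The iterates generated by one run: query points `xlow k`, and inner iterates `x k t` (primal)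
and `z k t` (dual), for `k = 1, …, N` and `t = 0, …, T k`. -/
structure Iterates (V κ : Type*) (d : ℕ) where
  xlow : ℕ → Stack V d
  x : ℕ → ℕ → Stack V d
  z : ℕ → ℕ → Stack κ d

namespace Iterates

variable {V κ : Type*} {d : ℕ} (I : Iterates V κ d) (a : Params) (x0 : Stack V d)

/-- The outer primal iterate `x_k = x_k^{T_k}` for `k ≥ 1`, with `x_0` the starting point. -/
def xOuter (k : ℕ) : Stack V d := if k = 0 then x0 else I.x k (a.T k)

/-- The outer dual iterate `z_k = z_k^{T_k}` for `k ≥ 1`, with `z_0 = 0`. -/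
def zOuter (k : ℕ) : Stack κ d := if k = 0 then 0 else I.z k (a.T k)

/-- The inner average `∑ t, x_k^t / T_k` for `k ≥ 1`, with initial value `x_0`. -/
def xHat (k : ℕ) : Stack V d :=
  if k = 0 then x0 else (1 / (a.T k : ℝ)) • ∑ t ∈ Finset.Icc 1 (a.T k), I.x k t

/-- The extrapolated point `x_{k-1} + λ_k (xHat_{k-1} - x_{k-2})`. For `k = 1` the convention
`x_{-1} = x_0` is the truncation `1 - 2 = 0`. -/
def xTilde (k : ℕ) : Stack V d :=
  I.xOuter a x0 (k - 1) + a.lam k • (I.xHat a x0 (k - 1) - I.xOuter a x0 (k - 2))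

/-- The point `x_k^{t-2}`. For `t = 1` it is `x_k^{-1}`, which is `x_{k-1}^{T_{k-1}-1}` if `k ≥ 2`
and `x_0` if `k = 1`. -/
def xLag (k t : ℕ) : Stack V d :=
  if t = 1 then (if k = 1 then x0 else I.x (k - 1) (a.T (k - 1) - 1)) else I.x k (t - 2)

/-- The extrapolated inner point `x_k^{t-1} + α_k^t (x_k^{t-1} - x_k^{t-2})`. -/
def uTilde (k t : ℕ) : Stack V d :=
  I.x k (t - 1) + a.α k t • (I.x k (t - 1) - I.xLag a x0 k t)

/-- The output `(∑ k, β_k)⁻¹ ∑ k, β_k xHat_k`. -/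
def output : Stack V d :=
  (∑ k ∈ Finset.Icc 1 a.N, a.β k)⁻¹ • ∑ k ∈ Finset.Icc 1 a.N, a.β k • I.xHat a x0 k

end Iterates

/-- `I` is a run of the algorithm from `x0` and `xlow0`, with constraint operator `M ⊗ I_d`, when
the gradient estimator of outer iteration `k` at the stacked query point `y` is `v k y`. Every
agent `i` minimizes over its own `X i`, with Euclidean prox terms. -/
structure IsRun {V κ : Type*} [Fintype V] [Fintype κ] {d : ℕ} (P : LocalData V d)
    (M : Matrix κ V ℝ) (a : Params) (v : ℕ → Stack V d → Stack V d) (x0 xlow0 : Stack V d)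
    (I : Iterates V κ d) : Prop where
  xlow_zero : I.xlow 0 = xlow0
  xlow_eq : ∀ k, 1 ≤ k → k ≤ a.N →
    I.xlow k = (1 / (1 + a.τ k)) • (I.xTilde a x0 k + a.τ k • I.xlow (k - 1))
  x_start : ∀ k, 1 ≤ k → k ≤ a.N → I.x k 0 = I.xOuter a x0 (k - 1)
  z_start : ∀ k, 1 ≤ k → k ≤ a.N → I.z k 0 = I.zOuter a (k - 1)
  z_step : ∀ k, 1 ≤ k → k ≤ a.N → ∀ t, 1 ≤ t → t ≤ a.T k → ∀ e,
    IsMinOn (fun w : EuclideanSpace ℝ (Fin d) =>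
      inner ℝ (-(blockOp d M (I.uTilde a x0 k t)) e) w
        + a.q k t / 2 * ‖w - I.z k (t - 1) e‖ ^ 2) Set.univ (I.z k t e)
  x_mem : ∀ k, 1 ≤ k → k ≤ a.N → ∀ t, 1 ≤ t → t ≤ a.T k → I.x k t ∈ P.feasible
  x_step : ∀ k, 1 ≤ k → k ≤ a.N → ∀ t, 1 ≤ t → t ≤ a.T k → ∀ i,
    IsMinOn (fun w : EuclideanSpace ℝ (Fin d) =>
      P.μ * P.ν i w
        + inner ℝ (v k (I.xlow k) i + blockOp d M.transpose (I.z k t) i) w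
        + a.η k t / 2 * ‖I.x k (t - 1) i - w‖ ^ 2
        + a.p k / 2 * ‖I.xOuter a x0 (k - 1) i - w‖ ^ 2) (P.X i) (I.x k t i)

/-- The samples `ξ k j i` (outer iteration `k`, sample number `j`, agent `i`): each `ξ k j i` has
the law of agent `i`, and the network-wide samples are independent over all `(k, j)`. Nothing is
assumed on the dependence between the agents within one network-wide sample. -/
structure IsSampling {V : Type*} [Fintype V] {d : ℕ} {P : LocalData V d} {Ξ : V → Type*}
    [∀ i, MeasurableSpace (Ξ i)] {σ : ℝ} (O : Oracle P Ξ σ) {Ω : Type*} [MeasurableSpace Ω]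
    (prob : Measure Ω) (ξ : ℕ → ℕ → Ω → ∀ i, Ξ i) : Prop where
  measurable : ∀ k j, Measurable (ξ k j)
  map_eq : ∀ k j i, prob.map (fun ω => ξ k j ω i) = O.law i
  indep : iIndepFun (fun (s : ℕ × ℕ) => ξ s.1 s.2) prob

end

end SPDS

/-! The core is the pathwise inequality `gap_bound`: for every feasible `u` with `A u = 0` and every
multiplier `z`, the weighted gap `f(output) - f(u) + ⟨A output, z⟩` is at most a quadratic in the
initial distances plus terms in the gradient errors `δ_k = v_k - ∇f̃(xlow_k)`. It joins two
telescoping arguments.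

`composite_bound` treats the inner primal-dual steps. Strong convexity of the prox problems and
extrapolation in the dual step give a potential that is passed on from step to step, and, with
weights `β_k / T_k`, from phase to phase. The proximity term anchored at `x_{k-1}` leaves a surplus
`p_k/2 ‖xHat_k - x_{k-1}‖²`.

`smooth_bound` treats the outer acceleration. The linearizations of `f̃` at the output and at the
query points are compared, and cocoercivity makes Bregman distances between query points pay for the
extrapolation error. This costs half of the surplus. The other half absorbs the part `⟨δ_k, xHat_k -
x_{k-1}⟩` of the noise by Young's inequality, which leaves `‖δ_k‖²/p_k` and `⟨δ_k, u - x_{k-1}⟩`.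

For expectations, `phaseAdapted` shows that `x_{k-1}` and `xlow_k` depend only on samples of earlier
phases. Hence the linear noise term has mean zero and `‖δ_k‖²` has mean at most `σ²/c_k`.
Measurability of the iterates is not assumed: each prox step is a Lipschitz function of its data.

Taking `z = 0` bounds the objective. For the residual, `z` has length at most `‖z*‖ + 1` and is
aligned with `A output`, and the saddle property bounds the objective gap below by `-‖z*‖ ‖A
output‖`. Such a `z` may depend on the outcome, since the noise terms do not involve it. -/

namespace SPDS

noncomputable section

/-! ### Prox inequalities and smooth convex functions -/

section Convexity

variable {E : Type*} [NormedAddCommGroup E] [InnerProductSpace ℝ E]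

/-- Minimality is compared with strong convexity on the segment from `y` to `w`. Dividing by the
weight `s` of `w` and letting `s → 0⁺` gives the full modulus without any differentiability. -/
theorem add_sq_le_of_isMinOn {X : Set E} {m : ℝ} {φ : E → ℝ} (hφ : StrongConvexOn X m φ)
    {y : E} (hy : y ∈ X) (hmin : IsMinOn φ X y) {w : E} (hw : w ∈ X) :
    φ y + m / 2 * ‖w - y‖ ^ 2 ≤ φ w := by
  have key : ∀ s : ℝ, 0 < s → s ≤ 1 → φ y + (1 - s) * (m / 2 * ‖w - y‖ ^ 2) ≤ φ w := by
    intro s hs hs1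
    have h1 := hφ.2 hw hy hs.le (sub_nonneg.2 hs1) (by ring)
    have h2 : φ y ≤ φ (s • w + (1 - s) • y) :=
      hmin (hφ.1 hw hy hs.le (sub_nonneg.2 hs1) (by ring))
    simp only [smul_eq_mul] at h1
    have h3 : s * (φ y + (1 - s) * (m / 2 * ‖w - y‖ ^ 2)) ≤ s * φ w := by nlinarith
    exact le_of_mul_le_mul_left h3 hs
  have hlim : Filter.Tendsto (fun s : ℝ => φ y + (1 - s) * (m / 2 * ‖w - y‖ ^ 2))
      (nhdsWithin 0 (Set.Ioi 0)) (nhds (φ y + (1 - 0) * (m / 2 * ‖w - y‖ ^ 2))) := by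
    refine Filter.Tendsto.mono_left (Continuous.tendsto ?_ 0) nhdsWithin_le_nhds
    fun_prop
  have h := le_of_tendsto hlim (by
    filter_upwards [Ioo_mem_nhdsGT (zero_lt_one' ℝ)] with s hs using key s hs.1 hs.2.le)
  linarith

theorem strongConvexOn_prox {X : Set E} {ν : E → ℝ} (hν : StrongConvexOn X 1 ν) {μ : ℝ}
    (hμ : 0 ≤ μ) (g a b : E) (η p : ℝ) :
    StrongConvexOn X (μ + η + p)
      (fun w => μ * ν w + inner ℝ g w + η / 2 * ‖a - w‖ ^ 2 + p / 2 * ‖b - w‖ ^ 2) := by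
  rw [strongConvexOn_iff_convex] at hν ⊢
  have h1 := hν.smul hμ
  have h2 : ConvexOn ℝ X (fun w => inner ℝ (g - η • a - p • b) w) :=
    ((innerSL ℝ (g - η • a - p • b)).toLinearMap.convexOn hν.1)
  have h3 := (h1.add h2).add_const (η / 2 * ‖a‖ ^ 2 + p / 2 * ‖b‖ ^ 2)
  refine h3.congr fun w _ => ?_
  simp only [Pi.add_apply, smul_eq_mul, inner_sub_left, real_inner_smul_left,
    norm_sub_sq_real]
  ring

theorem prox_three_point {X : Set E} {ν : E → ℝ} (hν : StrongConvexOn X 1 ν) {μ : ℝ}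
    (hμ : 0 ≤ μ) {g a b y : E} {η p : ℝ} (hy : y ∈ X)
    (hmin : IsMinOn (fun w => μ * ν w + inner ℝ g w + η / 2 * ‖a - w‖ ^ 2
      + p / 2 * ‖b - w‖ ^ 2) X y) {w : E} (hw : w ∈ X) :
    μ * ν y + inner ℝ g y + η / 2 * ‖a - y‖ ^ 2 + p / 2 * ‖b - y‖ ^ 2
      + (μ + η + p) / 2 * ‖w - y‖ ^ 2 ≤
    μ * ν w + inner ℝ g w + η / 2 * ‖a - w‖ ^ 2 + p / 2 * ‖b - w‖ ^ 2 :=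
  add_sq_le_of_isMinOn (strongConvexOn_prox hν hμ g a b η p) hy hmin hw

/-- Each minimizer is tested in the problem of the other. On adding, the values of `ν` cancel and
only the difference of the linear parts remains. This stability yields measurability and square
integrability of the iterates; the rate does not use it. -/
theorem prox_norm_sub_le {X : Set E} {ν : E → ℝ} (hν : StrongConvexOn X 1 ν) {μ : ℝ}
    (hμ : 0 ≤ μ) {g a b y g' a' b' y' : E} {η p : ℝ} (hη : 0 ≤ η) (hp : 0 < p)
    (hy : y ∈ X) (hy' : y' ∈ X)
    (hmin : IsMinOn (fun w => μ * ν w + inner ℝ g w + η / 2 * ‖a - w‖ ^ 2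
      + p / 2 * ‖b - w‖ ^ 2) X y)
    (hmin' : IsMinOn (fun w => μ * ν w + inner ℝ g' w + η / 2 * ‖a' - w‖ ^ 2
      + p / 2 * ‖b' - w‖ ^ 2) X y') :
    ‖y - y'‖ ≤ p⁻¹ * ‖(g - η • a - p • b) - (g' - η • a' - p • b')‖ := by
  have h1 := prox_three_point hν hμ hy hmin hy'
  have h2 := prox_three_point hν hμ hy' hmin' hy
  rw [norm_sub_rev y' y] at h1
  have h3 : inner ℝ ((g - η • a - p • b) - (g' - η • a' - p • b')) (y' - y) ≤
      ‖(g - η • a - p • b) - (g' - η • a' - p • b')‖ * ‖y - y'‖ := by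
    rw [norm_sub_rev y y']
    exact real_inner_le_norm _ _
  simp only [norm_sub_sq_real a, norm_sub_sq_real b, norm_sub_sq_real a',
    norm_sub_sq_real b'] at h1 h2
  have h4 : inner ℝ ((g - η • a - p • b) - (g' - η • a' - p • b')) (y' - y) =
      (inner ℝ g y' - η * inner ℝ a y' - p * inner ℝ b y')
      - (inner ℝ g y - η * inner ℝ a y - p * inner ℝ b y)
      - (inner ℝ g' y' - η * inner ℝ a' y' - p * inner ℝ b' y')
      + (inner ℝ g' y - η * inner ℝ a' y - p * inner ℝ b' y) := by
    simp only [inner_sub_left, inner_sub_right, real_inner_smul_left]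
    ring
  rw [h4] at h3
  set D := ‖(g - η • a - p • b) - (g' - η • a' - p • b')‖
  have h5 : (μ + η + p) * ‖y - y'‖ ^ 2 ≤ D * ‖y - y'‖ := by nlinarith
  have h6 : p * ‖y - y'‖ ^ 2 ≤ D * ‖y - y'‖ := by
    nlinarith [mul_nonneg (add_nonneg hμ hη) (sq_nonneg ‖y - y'‖)]
  rw [inv_mul_eq_div, le_div_iff₀ hp]
  rcases (norm_nonneg (y - y')).eq_or_lt with h0 | h0
  · rw [← h0, zero_mul]
    exact norm_nonneg _
  · nlinarith

theorem quadratic_min_eq {y a g : E} {q : ℝ} (hq : 0 < q)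
    (hmin : IsMinOn (fun w => inner ℝ g w + q / 2 * ‖w - a‖ ^ 2) Set.univ y) :
    y = a - q⁻¹ • g := by
  have h1 : inner ℝ g y + q / 2 * ‖y - a‖ ^ 2 ≤
      inner ℝ g (a - q⁻¹ • g) + q / 2 * ‖(a - q⁻¹ • g) - a‖ ^ 2 := hmin (Set.mem_univ _)
  have h2 : q / 2 * ‖y - (a - q⁻¹ • g)‖ ^ 2 =
      (inner ℝ g y + q / 2 * ‖y - a‖ ^ 2) -
      (inner ℝ g (a - q⁻¹ • g) + q / 2 * ‖(a - q⁻¹ • g) - a‖ ^ 2) := by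
    have e1 : y - (a - q⁻¹ • g) = (y - a) + q⁻¹ • g := by abel
    have e2 : (a - q⁻¹ • g) - a = -(q⁻¹ • g) := by abel
    rw [e1, e2, norm_add_sq_real, norm_neg, norm_smul, inner_sub_right, real_inner_smul_right,
      real_inner_smul_right, inner_sub_left, real_inner_self_eq_norm_sq, Real.norm_eq_abs,
      mul_pow, sq_abs, real_inner_comm y g, real_inner_comm a g]
    field_simp
    ring
  have h3 : ‖y - (a - q⁻¹ • g)‖ ^ 2 ≤ 0 := by
    by_contra! h
    nlinarith [mul_pos (half_pos hq) h]
  have h4 : ‖y - (a - q⁻¹ • g)‖ = 0 := by nlinarith [norm_nonneg (y - (a - q⁻¹ • g))]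
  exact sub_eq_zero.1 (norm_eq_zero.1 h4)

variable [CompleteSpace E]

theorem hasDerivAt_line {f : E → ℝ} (hf : Differentiable ℝ f) (x d : E) (s : ℝ) :
    HasDerivAt (fun s : ℝ => f (x + s • d)) (inner ℝ (gradient f (x + s • d)) d) s := by
  have h1 : HasDerivAt (fun s : ℝ => x + s • d) d s := by
    simpa using ((hasDerivAt_id s).smul_const d).const_add x
  have h2 := (hf (x + s • d)).hasFDerivAt.comp_hasDerivAt s h1
  rwa [inner_gradient_left]

theorem gradient_inequality {f : E → ℝ} (hc : ConvexOn ℝ Set.univ f) (hf : Differentiable ℝ f)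
    (x y : E) : f x + inner ℝ (gradient f x) (y - x) ≤ f y := by
  have h1 : ConvexOn ℝ Set.univ (fun s : ℝ => f (x + s • (y - x))) := by
    have := hc.comp_affineMap (AffineMap.lineMap x y : ℝ →ᵃ[ℝ] E)
    refine this.congr fun s _ => ?_
    simp [AffineMap.lineMap_apply, add_comm]
  have h2 := h1.le_slope_of_hasDerivAt (Set.mem_univ 0) (Set.mem_univ 1) one_pos
    (hasDerivAt_line hf x (y - x) 0)
  simp only [slope_def_field, zero_smul, add_zero, one_smul, add_sub_cancel, sub_zero, div_one] at h2
  linarith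

theorem descent_inequality {f : E → ℝ} (hf : Differentiable ℝ f) {L : ℝ≥0}
    (hL : LipschitzWith L (gradient f)) (x y : E) :
    f y ≤ f x + inner ℝ (gradient f x) (y - x) + L / 2 * ‖y - x‖ ^ 2 := by
  set d := y - x with hd
  have hder : ∀ s : ℝ, HasDerivAt (fun s : ℝ => f (x + s • d) - s * inner ℝ (gradient f x) d
      - L / 2 * s ^ 2 * ‖d‖ ^ 2) (inner ℝ (gradient f (x + s • d)) d - inner ℝ (gradient f x) d
      - L * s * ‖d‖ ^ 2) s := by
    intro s
    have h1 := (hasDerivAt_line hf x d s).sub ((hasDerivAt_id s).mul_const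
      (inner ℝ (gradient f x) d))
    have h2 := ((hasDerivAt_pow 2 s).const_mul ((L : ℝ) / 2)).mul_const (‖d‖ ^ 2)
    refine (h1.sub h2).congr_deriv ?_
    simp only [one_mul, Nat.cast_ofNat, Nat.add_one_sub_one, pow_one]
    ring
  have hanti : AntitoneOn (fun s : ℝ => f (x + s • d) - s * inner ℝ (gradient f x) d
      - L / 2 * s ^ 2 * ‖d‖ ^ 2) (Set.Icc 0 1) := by
    refine antitoneOn_of_deriv_nonpos (convex_Icc 0 1)
      (fun s _ => (hder s).continuousAt.continuousWithinAt)
      (fun s _ => (hder s).differentiableAt.differentiableWithinAt) fun s hs => ?_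
    rw [interior_Icc] at hs
    rw [(hder s).deriv, ← inner_sub_left]
    have h1 := real_inner_le_norm (gradient f (x + s • d) - gradient f x) d
    have h2 := hL.norm_sub_le (x + s • d) x
    rw [add_sub_cancel_left, norm_smul, Real.norm_eq_abs, abs_of_pos hs.1] at h2
    nlinarith [mul_le_mul_of_nonneg_right h2 (norm_nonneg d)]
  have h := hanti (Set.left_mem_Icc.2 zero_le_one) (Set.right_mem_Icc.2 zero_le_one) zero_le_one
  simp only [hd, one_smul, add_sub_cancel, zero_smul, add_zero] at h ⊢
  linarith

/-- The point `y - L⁻¹ (∇f y - ∇f x)` is bounded below by the tangent at `x` and above by the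
descent inequality at `y`. The case `L = 0`, where the gradient is constant, is separate. -/
theorem gradient_cocoercive {f : E → ℝ} (hc : ConvexOn ℝ Set.univ f) (hf : Differentiable ℝ f)
    {L : ℝ≥0} (hL : LipschitzWith L (gradient f)) (x y : E) :
    ‖gradient f y - gradient f x‖ ^ 2 ≤
      2 * L * (f y - f x - inner ℝ (gradient f x) (y - x)) := by
  rcases eq_or_ne L 0 with rfl | hL0
  · have := hL.norm_sub_le y x
    simp only [NNReal.coe_zero, zero_mul] at this
    have h0 := le_antisymm this (norm_nonneg _)
    rw [h0]
    simp
  have hLpos : (0 : ℝ) < L := NNReal.coe_pos.2 (pos_iff_ne_zero.2 hL0)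
  set D := gradient f y - gradient f x with hD
  have h1 := gradient_inequality hc hf x (y - (L : ℝ)⁻¹ • D)
  have h2 := descent_inequality hf hL y (y - (L : ℝ)⁻¹ • D)
  have e1 : y - (L : ℝ)⁻¹ • D - y = -((L : ℝ)⁻¹ • D) := by abel
  have e2 : y - (L : ℝ)⁻¹ • D - x = (y - x) - (L : ℝ)⁻¹ • D := by abel
  rw [e1, norm_neg, norm_smul, inner_neg_right, real_inner_smul_right, norm_inv,
    Real.norm_of_nonneg hLpos.le] at h2
  rw [e2, inner_sub_right, real_inner_smul_right] at h1
  have h3 : inner ℝ (gradient f y) D - inner ℝ (gradient f x) D = ‖D‖ ^ 2 := by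
    rw [← inner_sub_left, real_inner_self_eq_norm_sq]
  have h4 : (L : ℝ)⁻¹ * ‖D‖ ^ 2 - (L : ℝ) / 2 * ((L : ℝ)⁻¹ * ‖D‖) ^ 2 ≤
      f y - f x - inner ℝ (gradient f x) (y - x) := by
    rw [← h3]
    linarith
  have h5 : (L : ℝ)⁻¹ * ‖D‖ ^ 2 - (L : ℝ) / 2 * ((L : ℝ)⁻¹ * ‖D‖) ^ 2 = ‖D‖ ^ 2 / (2 * L) := by
    field_simp
    ring
  rw [h5, div_le_iff₀ (by positivity)] at h4
  linarith

end Convexity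

/-- The telescoping scheme behind all three Lyapunov arguments: step `k` receives `Ψ k` and hands
over `Φ k`. It serves inside a phase, across phases and for the smooth part. -/
theorem sum_add_le_of_chain {a Φ Ψ : ℕ → ℝ} {n : ℕ} (hn : 1 ≤ n)
    (h1 : ∀ k, 1 ≤ k → k ≤ n → a k + Φ k ≤ Ψ k)
    (h2 : ∀ k, 2 ≤ k → k ≤ n → Ψ k ≤ Φ (k - 1)) :
    ∑ k ∈ Finset.Icc 1 n, a k + Φ n ≤ Ψ 1 := by
  induction n, hn using Nat.le_induction with
  | base => simpa using h1 1 le_rfl le_rfl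
  | succ n hn ih =>
    rw [Finset.sum_Icc_succ_top (by omega)]
    have e1 := ih (fun k hk hk' => h1 k hk (by omega)) (fun k hk hk' => h2 k hk (by omega))
    have e2 := h1 (n + 1) (by omega) le_rfl
    have e3 := h2 (n + 1) (by omega) le_rfl
    rw [Nat.add_sub_cancel] at e3
    linarith

/-! ### Bilinear coupling and the dual step -/

section Hilbert

variable {H K : Type*} [NormedAddCommGroup H] [InnerProductSpace ℝ H]
  [NormedAddCommGroup K] [InnerProductSpace ℝ K]

theorem abs_inner_apply_le (A : H →L[ℝ] K) (x : H) (z : K) {c e q : ℝ} (hc : 0 ≤ c) (he : 0 ≤ e)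
    (hq : 0 < q) (h : c ^ 2 * ‖A‖ ^ 2 ≤ e * q) :
    c * |inner ℝ (A x) z| ≤ q / 2 * ‖z‖ ^ 2 + e / 2 * ‖x‖ ^ 2 := by
  have h1 : |inner ℝ (A x) z| ≤ ‖A‖ * ‖x‖ * ‖z‖ :=
    (abs_real_inner_le_norm _ _).trans (by gcongr; exact A.le_opNorm x)
  have h2 : (c * (‖A‖ * ‖x‖ * ‖z‖)) ^ 2 ≤ (e * ‖x‖ ^ 2) * (q * ‖z‖ ^ 2) := by
    calc (c * (‖A‖ * ‖x‖ * ‖z‖)) ^ 2 = (c ^ 2 * ‖A‖ ^ 2) * (‖x‖ ^ 2 * ‖z‖ ^ 2) := by ring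
      _ ≤ (e * q) * (‖x‖ ^ 2 * ‖z‖ ^ 2) := by gcongr
      _ = _ := by ring
  have h3 : |c * (‖A‖ * ‖x‖ * ‖z‖)| ≤ q / 2 * ‖z‖ ^ 2 + e / 2 * ‖x‖ ^ 2 := by
    refine abs_le_of_sq_le_sq (h2.trans ?_) (by positivity)
    nlinarith [sq_nonneg (e * ‖x‖ ^ 2 - q * ‖z‖ ^ 2)]
  exact (mul_le_mul_of_nonneg_left h1 hc).trans ((le_abs_self _).trans h3)

/-- The dual update is an explicit step, so the three-point identity is exact. Only the cross term
against `z₁ - z₀` needs Young's inequality: it uses up `q/2 ‖z₁ - z₀‖²` and leaves a multiple of `‖y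
- y'‖²`, to be paid by the previous primal step. The cross term against `z₀ - z` is kept for
telescoping. -/
theorem dual_step_inequality (A : H →L[ℝ] K) (x y y' : H) (z₁ z₀ z : K) {α q : ℝ} (hq : 0 < q)
    (hz : q • (z₁ - z₀) = A (y + α • (y - y'))) :
    inner ℝ (A x) z + q / 2 * ‖z - z₁‖ ^ 2 + inner ℝ (A (x - y)) (z₁ - z) ≤
      inner ℝ (A x) z₁ + q / 2 * ‖z - z₀‖ ^ 2 + α ^ 2 * ‖A‖ ^ 2 / (2 * q) * ‖y - y'‖ ^ 2
        + α * inner ℝ (A (y - y')) (z₀ - z) := by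
  have h1 : q * inner ℝ (z₁ - z₀) (z₁ - z) = inner ℝ (A y) (z₁ - z)
      + α * inner ℝ (A (y - y')) (z₁ - z) := by
    rw [← real_inner_smul_left, hz, map_add, map_smul, inner_add_left, real_inner_smul_left]
  have h2 : 2 * inner ℝ (z₁ - z₀) (z₁ - z) =
      ‖z₁ - z₀‖ ^ 2 + ‖z - z₁‖ ^ 2 - ‖z - z₀‖ ^ 2 := by
    have e : z - z₀ = (z₁ - z₀) - (z₁ - z) := by abel
    rw [e, norm_sub_sq_real (z₁ - z₀), norm_sub_rev z z₁]
    ring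
  have h3 := abs_inner_apply_le A (y - y') (z₁ - z₀) (c := |α|) (abs_nonneg α)
    (e := α ^ 2 * ‖A‖ ^ 2 / q) (by positivity) hq (by rw [sq_abs, div_mul_cancel₀ _ hq.ne'])
  rw [← abs_mul] at h3
  have h4 := (le_abs_self _).trans h3
  have h5 : inner ℝ (A (y - y')) (z₁ - z₀) =
      inner ℝ (A (y - y')) (z₁ - z) - inner ℝ (A (y - y')) (z₀ - z) := by
    rw [← inner_sub_right]
    congr 1
    abel
  have h6 : inner ℝ (A (x - y)) (z₁ - z) =
      inner ℝ (A x) z₁ - inner ℝ (A x) z - inner ℝ (A y) (z₁ - z) := by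
    rw [map_sub, inner_sub_left, inner_sub_right]
  have h7 : α ^ 2 * ‖A‖ ^ 2 / (2 * q) = α ^ 2 * ‖A‖ ^ 2 / q / 2 := by
    field_simp
  have h8 : q * inner ℝ (z₁ - z₀) (z₁ - z) =
      q / 2 * ‖z₁ - z₀‖ ^ 2 + q / 2 * ‖z - z₁‖ ^ 2 - q / 2 * ‖z - z₀‖ ^ 2 := by
    linear_combination q / 2 * h2
  rw [h5, mul_sub] at h4
  rw [h7]
  linarith

end Hilbert

theorem inner_blockOp {κ V : Type*} [Fintype κ] [Fintype V] (d : ℕ) (M : Matrix κ V ℝ)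
    (x : Stack V d) (z : Stack κ d) :
    inner ℝ (blockOp d M.transpose z) x = inner ℝ (blockOp d M x) z := by
  rw [PiLp.inner_apply, PiLp.inner_apply]
  have h1 : ∀ i, inner ℝ (blockOp d M.transpose z i) (x i) = ∑ e, M e i * inner ℝ (z e) (x i) := by
    intro i
    rw [blockOp_apply, sum_inner]
    exact Finset.sum_congr rfl fun e _ => real_inner_smul_left _ _ _
  have h2 : ∀ e, inner ℝ (blockOp d M x e) (z e) = ∑ i, M e i * inner ℝ (z e) (x i) := by
    intro e
    rw [blockOp_apply, sum_inner]
    exact Finset.sum_congr rfl fun i _ => by rw [real_inner_smul_left, real_inner_comm]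
  simp only [h1, h2]
  exact Finset.sum_comm

/-! ### The stacked objective and its Bregman distance -/

namespace LocalData

variable {V : Type*} {d : ℕ} (P : LocalData V d)

/-- The smooth part of the objective. -/
def smooth [Fintype V] (x : Stack V d) : ℝ := ∑ i, P.fs i (x i)

/-- The strongly convex part of the objective. -/
def reg [Fintype V] (x : Stack V d) : ℝ := ∑ i, P.μ * P.ν i (x i)

/-- The stacked gradient of the smooth part. -/
def grad (x : Stack V d) : Stack V d := WithLp.toLp 2 fun i => gradient (P.fs i) (x i)

theorem convex_feasible : Convex ℝ P.feasible := by
  intro x hx y hy s t hs ht hst i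
  exact P.convex_X i (hx i) (hy i) hs ht hst

variable [Fintype V]

theorem objective_eq (x : Stack V d) : P.objective x = P.smooth x + P.reg x :=
  Finset.sum_add_distrib

theorem convexOn_reg : ConvexOn ℝ P.feasible P.reg := by
  refine ⟨P.convex_feasible, fun x hx y hy s t hs ht hst => ?_⟩
  simp only [reg, Finset.smul_sum]
  rw [← Finset.sum_add_distrib]
  refine Finset.sum_le_sum fun i _ => ?_
  have h1 : ConvexOn ℝ (P.X i) (P.ν i) := UniformConvexOn.convexOn (P.strongConvexOn_ν i)
    fun r => by simp only [Pi.zero_apply]; positivity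
  exact (h1.smul P.μ_nonneg).2 (hx i) (hy i) hs ht hst

theorem smooth_add_inner_le (x y : Stack V d) :
    P.smooth x + inner ℝ (P.grad x) (y - x) ≤ P.smooth y := by
  rw [smooth, smooth, PiLp.inner_apply]
  rw [← Finset.sum_add_distrib]
  exact Finset.sum_le_sum fun i _ =>
    gradient_inequality (P.convexOn_fs i) (P.differentiable_fs i) (x i) (y i)

/-- The Bregman distance of the smooth part. -/
def bregman (x y : Stack V d) : ℝ := P.smooth y - P.smooth x - inner ℝ (P.grad x) (y - x)

theorem bregman_nonneg (x y : Stack V d) : 0 ≤ P.bregman x y := by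
  have := P.smooth_add_inner_le x y
  simp only [bregman]
  linarith

theorem norm_grad_sub_sq_le (x y : Stack V d) :
    ‖P.grad y - P.grad x‖ ^ 2 ≤ 2 * P.L * P.bregman x y := by
  rw [bregman, smooth, smooth, PiLp.inner_apply, PiLp.norm_sq_eq_of_L2]
  rw [← Finset.sum_sub_distrib, ← Finset.sum_sub_distrib, Finset.mul_sum]
  exact Finset.sum_le_sum fun i _ => gradient_cocoercive (P.convexOn_fs i)
    (P.differentiable_fs i) (P.lipschitz_gradient_fs i) (x i) (y i)

/-- Cocoercivity followed by Young's inequality: a change of gradient is paid partly by the Bregman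
distance, partly by `‖u‖²`. -/
theorem abs_inner_grad_sub_le (x y u : Stack V d) {c X Y : ℝ} (hc : 0 ≤ c) (hX : 0 ≤ X)
    (hY : 0 ≤ Y) (h : c ^ 2 * (2 * P.L) ≤ 4 * X * Y) :
    c * |inner ℝ (P.grad y - P.grad x) u| ≤ X * P.bregman x y + Y * ‖u‖ ^ 2 := by
  have hW := P.bregman_nonneg x y
  have h1 := abs_real_inner_le_norm (P.grad y - P.grad x) u
  have h2 := P.norm_grad_sub_sq_le x y
  refine (mul_le_mul_of_nonneg_left h1 hc).trans
    (abs_le_of_sq_le_sq' ?_ (by positivity)).2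
  calc (c * (‖P.grad y - P.grad x‖ * ‖u‖)) ^ 2
      = c ^ 2 * ‖u‖ ^ 2 * ‖P.grad y - P.grad x‖ ^ 2 := by ring
    _ ≤ c ^ 2 * ‖u‖ ^ 2 * (2 * P.L * P.bregman x y) := by gcongr
    _ = (c ^ 2 * (2 * P.L)) * (‖u‖ ^ 2 * P.bregman x y) := by ring
    _ ≤ (4 * X * Y) * (‖u‖ ^ 2 * P.bregman x y) := by gcongr
    _ ≤ _ := by nlinarith [sq_nonneg (X * P.bregman x y - Y * ‖u‖ ^ 2)]

end LocalData

/-! ### Signs implied by the parameter conditions -/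

namespace Params

variable {a : Params} {μ L nA : ℝ}

theorem Conditions.α_one_pos (h : a.Conditions μ L nA) (ha : a.Admissible) {k : ℕ} (hk : 2 ≤ k)
    (hkN : k ≤ a.N) : 0 < a.α k 1 := by
  have h1 := h.α_one_eq k hk hkN
  have hb := ha.β_pos k (by omega) hkN
  have hb' := ha.β_pos (k - 1) (by omega) (by omega)
  have hT : (0 : ℝ) < a.T k := by exact_mod_cast ha.one_le_T k (by omega) hkN
  have hT' : (0 : ℝ) < a.T (k - 1) := by exact_mod_cast ha.one_le_T (k - 1) (by omega) (by omega)
  have h2 : 0 < a.β k * a.T (k - 1) * a.α k 1 := by rw [h1]; positivity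
  exact pos_of_mul_pos_right h2 (by positivity)

/-- Every `η k t` occurs in a product with a positive `q` that dominates a nonnegative multiple of
`nA ^ 2`. Which condition supplies it depends on whether `t` is not last in its phase, last in a
phase that is not final, or last of all. -/
theorem Conditions.η_nonneg (h : a.Conditions μ L nA) (ha : a.Admissible) {k t : ℕ} (hk : 1 ≤ k)
    (hkN : k ≤ a.N) (ht : 1 ≤ t) (htT : t ≤ a.T k) : 0 ≤ a.η k t := by
  rcases htT.lt_or_eq with h1 | rfl
  · have h2 := h.nA_sq_le k hk hkN (t + 1) (by omega) (by omega)
    rw [Nat.add_sub_cancel] at h2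
    exact nonneg_of_mul_nonneg_left ((sq_nonneg _).trans h2)
      (ha.q_pos k hk hkN (t + 1) (by omega) (by omega))
  rcases hkN.lt_or_eq with h1 | rfl
  · have h2 := h.α_one_mul_le (k + 1) (by omega) (by omega)
    rw [Nat.add_sub_cancel] at h2
    have h3 := h.α_one_pos ha (k := k + 1) (by omega) (by omega)
    exact nonneg_of_mul_nonneg_left ((mul_nonneg h3.le (sq_nonneg _)).trans h2)
      (ha.q_pos (k + 1) (by omega) (by omega) 1 le_rfl (ha.one_le_T _ (by omega) (by omega)))
  · exact nonneg_of_mul_nonneg_left ((sq_nonneg _).trans h.nA_sq_le_last)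
      (ha.q_pos _ hk le_rfl _ ht le_rfl)

theorem Conditions.τ_nonneg (h : a.Conditions μ L nA) (ha : a.Admissible) (hL : 0 ≤ L) {k : ℕ}
    (hk : 1 ≤ k) (hkN : k ≤ a.N) : 0 ≤ a.τ k := by
  rcases hk.eq_or_lt with rfl | hk
  · rw [h.τ_one]
  have h1 := h.β_eq k hk hkN
  have hb := ha.β_pos k (by omega) hkN
  have hb' := ha.β_pos (k - 1) (by omega) (by omega)
  have h2 : 0 < a.lam k := pos_of_mul_pos_right (h1 ▸ hb') hb.le
  have h3 := h.L_mul_lam_le k hk hkN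
  exact nonneg_of_mul_nonneg_right ((by positivity : 0 ≤ 2 * L * a.lam k).trans h3)
    (ha.p_pos (k - 1) (by omega) (by omega))

end Params

/-! ### One inner step -/

section Run

variable {V κ : Type*} {d : ℕ}

namespace Iterates

theorem xOuter_zero (I : Iterates V κ d) (a : Params) (x0 : Stack V d) :
    I.xOuter a x0 0 = x0 := if_pos rfl

theorem xOuter_of_pos (I : Iterates V κ d) (a : Params) (x0 : Stack V d) {k : ℕ} (hk : 1 ≤ k) :
    I.xOuter a x0 k = I.x k (a.T k) := if_neg (by omega)

theorem xHat_zero (I : Iterates V κ d) (a : Params) (x0 : Stack V d) :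
    I.xHat a x0 0 = x0 := if_pos rfl

theorem smul_xHat (I : Iterates V κ d) (a : Params) (x0 : Stack V d) {k : ℕ} (hk : 1 ≤ k)
    (hT : 1 ≤ a.T k) :
    (a.T k : ℝ) • I.xHat a x0 k = ∑ t ∈ Finset.Icc 1 (a.T k), I.x k t := by
  have hT' : (a.T k : ℝ) ≠ 0 := by positivity
  rw [xHat, if_neg (by omega), smul_smul, mul_one_div_cancel hT', one_smul]

theorem smul_output (I : Iterates V κ d) {a : Params} (ha : a.Admissible) (x0 : Stack V d) :
    (∑ k ∈ Finset.Icc 1 a.N, a.β k) • I.output a x0 =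
      ∑ k ∈ Finset.Icc 1 a.N, a.β k • I.xHat a x0 k := by
  have h : 0 < ∑ k ∈ Finset.Icc 1 a.N, a.β k :=
    Finset.sum_pos (fun k hk => ha.β_pos k (Finset.mem_Icc.1 hk).1 (Finset.mem_Icc.1 hk).2)
      ⟨1, Finset.mem_Icc.2 ⟨le_rfl, ha.one_le_N⟩⟩
  rw [output, smul_smul, mul_inv_cancel₀ h.ne', one_smul]

variable [Fintype V] [Fintype κ]

/-- The part of the Lyapunov function that inner step `t` of phase `k` hands over. -/
def endPotential (I : Iterates V κ d) (a : Params) (A : Stack V d →L[ℝ] Stack κ d) (μ : ℝ)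
    (u : Stack V d) (z : Stack κ d) (k t : ℕ) : ℝ :=
  (μ + a.η k t + a.p k) / 2 * ‖u - I.x k t‖ ^ 2 + a.q k t / 2 * ‖z - I.z k t‖ ^ 2
    + a.η k t / 2 * ‖I.x k t - I.x k (t - 1)‖ ^ 2
    + inner ℝ (A (I.x k t - I.x k (t - 1))) (I.z k t - z)

/-- The part of the Lyapunov function that inner step `t` of phase `k` receives. -/
def startPotential (I : Iterates V κ d) (a : Params) (x0 : Stack V d)
    (A : Stack V d →L[ℝ] Stack κ d) (u : Stack V d) (z : Stack κ d) (k t : ℕ) : ℝ :=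
  a.η k t / 2 * ‖u - I.x k (t - 1)‖ ^ 2 + a.q k t / 2 * ‖z - I.z k (t - 1)‖ ^ 2
    + a.α k t ^ 2 * ‖A‖ ^ 2 / (2 * a.q k t) * ‖I.x k (t - 1) - I.xLag a x0 k t‖ ^ 2
    + a.α k t * inner ℝ (A (I.x k (t - 1) - I.xLag a x0 k t)) (I.z k (t - 1) - z)

end Iterates

variable [Fintype V] [Fintype κ] {P : LocalData V d} {M : Matrix κ V ℝ} {a : Params}
  {v : ℕ → Stack V d → Stack V d} {x0 xlow0 : Stack V d} {I : Iterates V κ d}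

namespace IsRun

theorem xHat_mem (h : IsRun P M a v x0 xlow0 I) (ha : a.Admissible) {k : ℕ} (hk : 1 ≤ k)
    (hkN : k ≤ a.N) : I.xHat a x0 k ∈ P.feasible := by
  have hT := ha.one_le_T k hk hkN
  rw [Iterates.xHat, if_neg (by omega), Finset.smul_sum]
  refine P.convex_feasible.sum_mem (fun t _ => by positivity) ?_ fun t ht =>
    h.x_mem k hk hkN t (Finset.mem_Icc.1 ht).1 (Finset.mem_Icc.1 ht).2
  have : (a.T k : ℝ) ≠ 0 := by positivity
  simp [this]

theorem reg_xHat_le (h : IsRun P M a v x0 xlow0 I) (ha : a.Admissible) {k : ℕ} (hk : 1 ≤ k)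
    (hkN : k ≤ a.N) :
    a.T k * P.reg (I.xHat a x0 k) ≤ ∑ t ∈ Finset.Icc 1 (a.T k), P.reg (I.x k t) := by
  have hT := ha.one_le_T k hk hkN
  have hT' : (0 : ℝ) < a.T k := by positivity
  have h1 := P.convexOn_reg.map_sum_le (t := Finset.Icc 1 (a.T k)) (w := fun _ => 1 / (a.T k : ℝ))
    (p := fun t => I.x k t) (fun t _ => by positivity) (by simp [hT'.ne'])
    (fun t ht => h.x_mem k hk hkN t (Finset.mem_Icc.1 ht).1 (Finset.mem_Icc.1 ht).2)
  rw [← Finset.smul_sum, ← Finset.smul_sum, smul_eq_mul, one_div_mul_eq_div, le_div_iff₀ hT'] at h1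
  rw [Iterates.xHat, if_neg (by omega), mul_comm]
  exact h1

theorem output_mem (h : IsRun P M a v x0 xlow0 I) (ha : a.Admissible) :
    I.output a x0 ∈ P.feasible := by
  have hB : 0 < ∑ k ∈ Finset.Icc 1 a.N, a.β k :=
    Finset.sum_pos (fun k hk => ha.β_pos k (Finset.mem_Icc.1 hk).1 (Finset.mem_Icc.1 hk).2)
      ⟨1, Finset.mem_Icc.2 ⟨le_rfl, ha.one_le_N⟩⟩
  rw [Iterates.output, Finset.smul_sum]
  simp only [smul_smul]
  refine P.convex_feasible.sum_mem (fun k hk => ?_) ?_ fun k hk =>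
    h.xHat_mem ha (Finset.mem_Icc.1 hk).1 (Finset.mem_Icc.1 hk).2
  · have := ha.β_pos k (Finset.mem_Icc.1 hk).1 (Finset.mem_Icc.1 hk).2
    positivity
  · rw [← Finset.mul_sum, inv_mul_cancel₀ hB.ne']

theorem reg_output_le (h : IsRun P M a v x0 xlow0 I) (ha : a.Admissible) :
    (∑ k ∈ Finset.Icc 1 a.N, a.β k) * P.reg (I.output a x0) ≤
      ∑ k ∈ Finset.Icc 1 a.N, a.β k * P.reg (I.xHat a x0 k) := by
  have hβ : ∀ k ∈ Finset.Icc 1 a.N, 0 < a.β k :=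
    fun k hk => ha.β_pos k (Finset.mem_Icc.1 hk).1 (Finset.mem_Icc.1 hk).2
  have hB : 0 < ∑ k ∈ Finset.Icc 1 a.N, a.β k :=
    Finset.sum_pos hβ ⟨1, Finset.mem_Icc.2 ⟨le_rfl, ha.one_le_N⟩⟩
  have h1 := P.convexOn_reg.map_centerMass_le (t := Finset.Icc 1 a.N) (w := a.β)
    (p := fun k => I.xHat a x0 k) (fun k hk => (hβ k hk).le) hB
    (fun k hk => h.xHat_mem ha (Finset.mem_Icc.1 hk).1 (Finset.mem_Icc.1 hk).2)
  simp only [Finset.centerMass, smul_eq_mul, Function.comp_apply] at h1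
  rw [inv_mul_eq_div, le_div_iff₀ hB, mul_comm] at h1
  exact h1

theorem primal_step (h : IsRun P M a v x0 xlow0 I) {k t : ℕ} (hk : 1 ≤ k) (hkN : k ≤ a.N)
    (ht : 1 ≤ t) (htT : t ≤ a.T k) {u : Stack V d} (hu : u ∈ P.feasible) :
    P.reg (I.x k t) - P.reg u + inner ℝ (v k (I.xlow k)) (I.x k t - u)
      + inner ℝ (blockOp d M (I.x k t - u)) (I.z k t)
      + a.η k t / 2 * ‖I.x k t - I.x k (t - 1)‖ ^ 2
      + a.p k / 2 * ‖I.xOuter a x0 (k - 1) - I.x k t‖ ^ 2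
      + (P.μ + a.η k t + a.p k) / 2 * ‖u - I.x k t‖ ^ 2 ≤
    a.η k t / 2 * ‖u - I.x k (t - 1)‖ ^ 2 + a.p k / 2 * ‖I.xOuter a x0 (k - 1) - u‖ ^ 2 := by
  have hi := fun i => prox_three_point (P.strongConvexOn_ν i) P.μ_nonneg
    (h.x_mem k hk hkN t ht htT i) (h.x_step k hk hkN t ht htT i) (hu i)
  have hs := Finset.sum_le_sum fun i (_ : i ∈ Finset.univ) => hi i
  simp only [Finset.sum_add_distrib, ← Finset.mul_sum] at hs
  have n : ∀ y y' : Stack V d, ∑ i, ‖y i - y' i‖ ^ 2 = ‖y - y'‖ ^ 2 :=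
    fun y y' => (PiLp.norm_sq_eq_of_L2 _ (y - y')).symm
  have ip : ∀ y : Stack V d, ∑ i, inner ℝ (v k (I.xlow k) i + blockOp d M.transpose (I.z k t) i)
      (y i) = inner ℝ (v k (I.xlow k)) y + inner ℝ (blockOp d M y) (I.z k t) := by
    intro y
    rw [← inner_blockOp, ← inner_add_left, PiLp.inner_apply]
    rfl
  rw [n, n, n, n, n, ip, ip] at hs
  have e1 : P.reg (I.x k t) = P.μ * ∑ i, P.ν i (I.x k t i) := (Finset.mul_sum _ _ _).symm
  have e2 : P.reg u = P.μ * ∑ i, P.ν i (u i) := (Finset.mul_sum _ _ _).symm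
  rw [e1, e2, map_sub, inner_sub_left, inner_sub_right,
    norm_sub_rev u (I.x k (t - 1)), norm_sub_rev (I.x k t) (I.x k (t - 1))]
  linarith

theorem dual_step (h : IsRun P M a v x0 xlow0 I) (ha : a.Admissible) {k t : ℕ} (hk : 1 ≤ k)
    (hkN : k ≤ a.N) (ht : 1 ≤ t) (htT : t ≤ a.T k) :
    I.z k t = I.z k (t - 1) + (a.q k t)⁻¹ • blockOp d M (I.uTilde a x0 k t) := by
  ext1 e
  have h1 := quadratic_min_eq (ha.q_pos k hk hkN t ht htT) (h.z_step k hk hkN t ht htT e)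
  rw [h1, smul_neg, sub_neg_eq_add]
  rfl

/-- Since `A u = 0`, the coupling term of the primal inequality is `⟨A x_k^t, z_k^t⟩`, which cancels
against the same term in the dual inequality and leaves `⟨A x_k^t, z⟩` for the fixed multiplier. -/
theorem inner_step (h : IsRun P M a v x0 xlow0 I) (ha : a.Admissible) {k t : ℕ} (hk : 1 ≤ k)
    (hkN : k ≤ a.N) (ht : 1 ≤ t) (htT : t ≤ a.T k) {u : Stack V d} (hu : u ∈ P.feasible)
    (hAu : blockOp d M u = 0) (z : Stack κ d) :
    (P.reg (I.x k t) - P.reg u + inner ℝ (v k (I.xlow k)) (I.x k t - u)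
      + inner ℝ (blockOp d M (I.x k t)) z
      + a.p k / 2 * ‖I.xOuter a x0 (k - 1) - I.x k t‖ ^ 2
      - a.p k / 2 * ‖I.xOuter a x0 (k - 1) - u‖ ^ 2)
      + I.endPotential a (blockOp d M) P.μ u z k t ≤
    I.startPotential a x0 (blockOp d M) u z k t := by
  have hq := ha.q_pos k hk hkN t ht htT
  have h1 := h.primal_step hk hkN ht htT hu
  have h2 := dual_step_inequality (blockOp d M) (I.x k t) (I.x k (t - 1)) (I.xLag a x0 k t)
    (I.z k t) (I.z k (t - 1)) z (α := a.α k t) hq (by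
      rw [h.dual_step ha hk hkN ht htT, add_sub_cancel_left, smul_inv_smul₀ hq.ne']
      rfl)
  rw [map_sub, hAu, sub_zero] at h1
  simp only [Iterates.endPotential, Iterates.startPotential]
  linarith

end IsRun

end Run

/-! ### Deterministic analysis of a run -/

namespace IsRun

variable {V κ : Type*} {d : ℕ} [Fintype V] [Fintype κ] {P : LocalData V d} {M : Matrix κ V ℝ}
  {a : Params} {v : ℕ → Stack V d → Stack V d} {x0 xlow0 : Stack V d} {I : Iterates V κ d}

theorem startPotential_le (ha : a.Admissible)
    (hc : a.Conditions P.μ P.L ‖blockOp d M‖) {k t : ℕ} (hk : 1 ≤ k) (hkN : k ≤ a.N)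
    (ht : 2 ≤ t) (htT : t ≤ a.T k) (u : Stack V d) (z : Stack κ d) :
    I.startPotential a x0 (blockOp d M) u z k t ≤
      I.endPotential a (blockOp d M) P.μ u z k (t - 1) := by
  have hq := ha.q_pos k hk hkN t (by omega) htT
  have h1 := hc.nA_sq_le k hk hkN t ht htT
  have h2 : I.xLag a x0 k t = I.x k (t - 1 - 1) := by
    rw [Iterates.xLag, if_neg (by omega), Nat.sub_sub]
  simp only [Iterates.endPotential, Iterates.startPotential, h2, hc.α_eq_one k hk hkN t ht htT]
  have h3 : (1 : ℝ) ^ 2 * ‖blockOp d M‖ ^ 2 / (2 * a.q k t) ≤ a.η k (t - 1) / 2 := by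
    rw [div_le_div_iff₀ (by positivity) two_pos]
    linarith
  have h4 := hc.q_anti k hk hkN t ht htT
  have h5 := hc.η_le k hk hkN t ht htT
  rw [one_mul]
  gcongr

/-- All `T k` inner steps carry the same anchor term at `x_{k-1}`, which is also the first inner
iterate of phase `k`. Their sum therefore merges with the initial distance term, whence the
coefficient `η_k^1 + p_k T_k`. The choice of `α_k^1` makes the weighted bilinear terms of the two
phases equal. -/
theorem smul_startPotential_le (h : IsRun P M a v x0 xlow0 I) (ha : a.Admissible)
    (hc : a.Conditions P.μ P.L ‖blockOp d M‖) {k : ℕ} (hk : 2 ≤ k) (hkN : k ≤ a.N)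
    (u : Stack V d) (z : Stack κ d) :
    a.β k / a.T k * (I.startPotential a x0 (blockOp d M) u z k 1
      + a.T k * (a.p k / 2 * ‖I.xOuter a x0 (k - 1) - u‖ ^ 2)) ≤
    a.β (k - 1) / a.T (k - 1) * I.endPotential a (blockOp d M) P.μ u z (k - 1) (a.T (k - 1)) := by
  have hT : (0 : ℝ) < a.T k := by exact_mod_cast ha.one_le_T k (by omega) hkN
  have hT' : (0 : ℝ) < a.T (k - 1) := by exact_mod_cast ha.one_le_T (k - 1) (by omega) (by omega)
  have hq := ha.q_pos k (by omega) hkN 1 le_rfl (ha.one_le_T k (by omega) hkN)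
  have hβ := ha.β_pos k (by omega) hkN
  have hβ' := ha.β_pos (k - 1) (by omega) (by omega)
  have hα := hc.α_one_pos ha hk hkN
  have e1 : I.x k (1 - 1) = I.x (k - 1) (a.T (k - 1)) := by
    rw [Nat.sub_self, h.x_start k (by omega) hkN, Iterates.xOuter_of_pos _ _ _ (by omega)]
  have e2 : I.z k (1 - 1) = I.z (k - 1) (a.T (k - 1)) := by
    rw [Nat.sub_self, h.z_start k (by omega) hkN, Iterates.zOuter, if_neg (by omega)]
  have e3 : I.xLag a x0 k 1 = I.x (k - 1) (a.T (k - 1) - 1) := by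
    rw [Iterates.xLag, if_pos rfl, if_neg (by omega)]
  have e4 : I.xOuter a x0 (k - 1) = I.x (k - 1) (a.T (k - 1)) :=
    Iterates.xOuter_of_pos _ _ _ (by omega)
  rw [Iterates.endPotential, Iterates.startPotential, e1, e2, e3, e4, norm_sub_rev _ u]
  set w := a.β k / a.T k with hw
  set w' := a.β (k - 1) / a.T (k - 1) with hw'
  have hwpos : 0 < w := div_pos hβ hT
  have hwα : w * a.α k 1 = w' := by
    have := hc.α_one_eq k hk hkN
    rw [hw, hw', div_mul_eq_mul_div, div_eq_div_iff hT.ne' hT'.ne']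
    linarith
  have c1 : w * (a.η k 1 / 2 + a.T k * (a.p k / 2)) ≤
      w' * ((P.μ + a.η (k - 1) (a.T (k - 1)) + a.p (k - 1)) / 2) := by
    have := hc.η_one_le k hk hkN
    rw [hw, hw', div_mul_eq_mul_div, div_mul_eq_mul_div, div_le_div_iff₀ hT hT']
    linarith
  have c2 : w * (a.q k 1 / 2) ≤ w' * (a.q (k - 1) (a.T (k - 1)) / 2) := by
    have := hc.q_one_le k hk hkN
    rw [hw, hw', div_mul_eq_mul_div, div_mul_eq_mul_div, div_le_div_iff₀ hT hT']
    linarith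
  -- One factor `α_k^1` turns `w` into `w'`; the other is used up by `α_k^1 ‖A‖² ≤ η q`.
  have c3 : w * (a.α k 1 ^ 2 * ‖blockOp d M‖ ^ 2 / (2 * a.q k 1)) ≤
      w' * (a.η (k - 1) (a.T (k - 1)) / 2) := by
    have := hc.α_one_mul_le k hk hkN
    rw [← hwα, mul_assoc]
    gcongr
    rw [div_le_iff₀ (by positivity)]
    nlinarith
  have d1 := mul_le_mul_of_nonneg_right c1 (sq_nonneg ‖u - I.x (k - 1) (a.T (k - 1))‖)
  have d2 := mul_le_mul_of_nonneg_right c2 (sq_nonneg ‖z - I.z (k - 1) (a.T (k - 1))‖)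
  have d3 := mul_le_mul_of_nonneg_right c3
    (sq_nonneg ‖I.x (k - 1) (a.T (k - 1)) - I.x (k - 1) (a.T (k - 1) - 1)‖)
  set D := inner ℝ (blockOp d M (I.x (k - 1) (a.T (k - 1)) - I.x (k - 1) (a.T (k - 1) - 1)))
    (I.z (k - 1) (a.T (k - 1)) - z)
  have d4 : w * (a.α k 1 * D) = w' * D := by rw [← hwα, mul_assoc]
  linarith

theorem endPotential_nonneg (ha : a.Admissible)
    (hc : a.Conditions P.μ P.L ‖blockOp d M‖) (u : Stack V d) (z : Stack κ d) :
    0 ≤ I.endPotential a (blockOp d M) P.μ u z a.N (a.T a.N) := by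
  have hT := ha.one_le_T a.N ha.one_le_N le_rfl
  have hη := hc.η_nonneg ha ha.one_le_N le_rfl hT le_rfl
  have hp := ha.p_pos a.N ha.one_le_N le_rfl
  have hμ := P.μ_nonneg
  have h1 := abs_inner_apply_le (blockOp d M) (I.x a.N (a.T a.N) - I.x a.N (a.T a.N - 1))
    (I.z a.N (a.T a.N) - z) zero_le_one hη (ha.q_pos a.N ha.one_le_N le_rfl _ hT le_rfl)
    (by rw [one_pow, one_mul]; exact hc.nA_sq_le_last)
  have h2 := neg_abs_le (inner ℝ (blockOp d M (I.x a.N (a.T a.N) - I.x a.N (a.T a.N - 1)))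
    (I.z a.N (a.T a.N) - z))
  have h3 : 0 ≤ (P.μ + a.η a.N (a.T a.N) + a.p a.N) / 2 * ‖u - I.x a.N (a.T a.N)‖ ^ 2 := by
    positivity
  rw [Iterates.endPotential, norm_sub_rev z]
  linarith

theorem startPotential_first (h : IsRun P M a v x0 xlow0 I) (ha : a.Admissible) (u : Stack V d)
    (z : Stack κ d) :
    a.β 1 / a.T 1 * (I.startPotential a x0 (blockOp d M) u z 1 1
      + a.T 1 * (a.p 1 / 2 * ‖I.xOuter a x0 (1 - 1) - u‖ ^ 2)) =
    a.β 1 * a.q 1 1 / (2 * a.T 1) * ‖z‖ ^ 2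
      + a.β 1 / 2 * (a.η 1 1 / a.T 1 + a.p 1) * ‖x0 - u‖ ^ 2 := by
  have hT : (a.T 1 : ℝ) ≠ 0 := by
    have := ha.one_le_T 1 le_rfl ha.one_le_N
    positivity
  have e1 : I.x 1 (1 - 1) = x0 := by
    rw [Nat.sub_self, h.x_start 1 le_rfl ha.one_le_N, Nat.sub_self, Iterates.xOuter_zero]
  have e2 : I.z 1 (1 - 1) = 0 := by
    rw [Nat.sub_self, h.z_start 1 le_rfl ha.one_le_N, Nat.sub_self, Iterates.zOuter, if_pos rfl]
  have e3 : I.xLag a x0 1 1 = x0 := by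
    rw [Iterates.xLag, if_pos rfl, if_pos rfl]
  rw [Iterates.startPotential, e1, e2, e3, Nat.sub_self, Iterates.xOuter_zero, sub_self, map_zero,
    inner_zero_left, norm_zero, sub_zero, norm_sub_rev u]
  field_simp
  ring

theorem le_sum_inner (h : IsRun P M a v x0 xlow0 I) (ha : a.Admissible) {k : ℕ} (hk : 1 ≤ k)
    (hkN : k ≤ a.N) (u : Stack V d) (z : Stack κ d) :
    a.T k * (P.reg (I.xHat a x0 k) - P.reg u + inner ℝ (v k (I.xlow k)) (I.xHat a x0 k - u)
      + inner ℝ (blockOp d M (I.xHat a x0 k)) z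
      + a.p k / 2 * ‖I.xHat a x0 k - I.xOuter a x0 (k - 1)‖ ^ 2) ≤
    ∑ t ∈ Finset.Icc 1 (a.T k), (P.reg (I.x k t) - P.reg u
      + inner ℝ (v k (I.xlow k)) (I.x k t - u) + inner ℝ (blockOp d M (I.x k t)) z
      + a.p k / 2 * ‖I.xOuter a x0 (k - 1) - I.x k t‖ ^ 2) := by
  have hT := ha.one_le_T k hk hkN
  have hp := ha.p_pos k hk hkN
  have hx := I.smul_xHat a x0 hk hT
  set y := I.xHat a x0 k
  set b := I.xOuter a x0 (k - 1)
  have h1 := h.reg_xHat_le ha hk hkN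
  -- The squared norm is replaced by its tangent at the average `y`. After this all remaining sums
  -- over `t` except that of `reg` are affine in the iterates, hence exact.
  have h2 : ∀ t ∈ Finset.Icc 1 (a.T k), P.reg (I.x k t) - P.reg u
      + inner ℝ (v k (I.xlow k)) (I.x k t - u) + inner ℝ (blockOp d M (I.x k t)) z
      + a.p k / 2 * (2 * inner ℝ (b - y) (b - I.x k t) - ‖y - b‖ ^ 2) ≤
      P.reg (I.x k t) - P.reg u
      + inner ℝ (v k (I.xlow k)) (I.x k t - u) + inner ℝ (blockOp d M (I.x k t)) z
      + a.p k / 2 * ‖b - I.x k t‖ ^ 2 := by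
    intro t _
    gcongr
    have h3 := sq_nonneg ‖(b - y) - (b - I.x k t)‖
    rw [norm_sub_sq_real, norm_sub_rev b y] at h3
    linarith
  refine le_trans (le_of_eq_of_le ?_ (add_le_add_left h1 (a.T k * (- P.reg u
    + inner ℝ (v k (I.xlow k)) (y - u) + inner ℝ (blockOp d M y) z
      + a.p k / 2 * ‖y - b‖ ^ 2)))) (le_of_eq_of_le ?_ (Finset.sum_le_sum h2))
  · ring
  have s1 : ∑ t ∈ Finset.Icc 1 (a.T k), inner ℝ (v k (I.xlow k)) (I.x k t) =
      a.T k * inner ℝ (v k (I.xlow k)) y := by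
    rw [← inner_sum, ← hx, real_inner_smul_right]
  have s2 : ∑ t ∈ Finset.Icc 1 (a.T k), inner ℝ (blockOp d M (I.x k t)) z =
      a.T k * inner ℝ (blockOp d M y) z := by
    rw [← sum_inner, ← map_sum, ← hx, map_smul, real_inner_smul_left]
  have s3 : ∑ t ∈ Finset.Icc 1 (a.T k), inner ℝ (b - y) (I.x k t) =
      a.T k * inner ℝ (b - y) y := by
    rw [← inner_sum, ← hx, real_inner_smul_right]
  have s4 : inner ℝ (b - y) b - inner ℝ (b - y) y = ‖y - b‖ ^ 2 := by
    rw [← inner_sub_right, real_inner_self_eq_norm_sq, norm_sub_rev]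
  simp only [inner_sub_right _ _ u, inner_sub_right _ b, mul_sub, Finset.sum_add_distrib,
    Finset.sum_sub_distrib, ← Finset.mul_sum, s1, s2, s3, Finset.sum_const, Nat.card_Icc,
    Nat.add_sub_cancel, nsmul_eq_mul]
  linear_combination (-(a.p k) * a.T k) * s4

theorem composite_bound (h : IsRun P M a v x0 xlow0 I) (ha : a.Admissible)
    (hc : a.Conditions P.μ P.L ‖blockOp d M‖) {u : Stack V d} (hu : u ∈ P.feasible)
    (hAu : blockOp d M u = 0) (z : Stack κ d) :
    ∑ k ∈ Finset.Icc 1 a.N, a.β k * (P.reg (I.xHat a x0 k) - P.reg u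
      + inner ℝ (v k (I.xlow k)) (I.xHat a x0 k - u) + inner ℝ (blockOp d M (I.xHat a x0 k)) z
      + a.p k / 2 * ‖I.xHat a x0 k - I.xOuter a x0 (k - 1)‖ ^ 2) ≤
    a.β 1 * a.q 1 1 / (2 * a.T 1) * ‖z‖ ^ 2
      + a.β 1 / 2 * (a.η 1 1 / a.T 1 + a.p 1) * ‖x0 - u‖ ^ 2 := by
  rw [← h.startPotential_first ha u z]
  refine le_trans (le_add_of_nonneg_right (mul_nonneg (div_nonneg
    (ha.β_pos a.N ha.one_le_N le_rfl).le (Nat.cast_nonneg _))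
    (endPotential_nonneg (I := I) ha hc u z))) (sum_add_le_of_chain
      (Φ := fun k => a.β k / a.T k * I.endPotential a (blockOp d M) P.μ u z k (a.T k))
      (Ψ := fun k => a.β k / a.T k * (I.startPotential a x0 (blockOp d M) u z k 1
        + a.T k * (a.p k / 2 * ‖I.xOuter a x0 (k - 1) - u‖ ^ 2))) ha.one_le_N ?_
      fun k hk hkN => h.smul_startPotential_le ha hc hk hkN u z)
  intro k hk hkN
  have hT := ha.one_le_T k hk hkN
  have hT' : (0 : ℝ) < a.T k := by positivity
  have hβ := ha.β_pos k hk hkN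
  have h1 := sum_add_le_of_chain hT
    (fun t ht htT => h.inner_step ha hk hkN ht htT hu hAu z)
    (fun t ht htT => startPotential_le ha hc hk hkN ht htT u z)
  have h2 := h.le_sum_inner ha hk hkN u z
  rw [Finset.sum_sub_distrib, Finset.sum_const, Nat.card_Icc, Nat.add_sub_cancel,
    nsmul_eq_mul] at h1
  set S := P.reg (I.xHat a x0 k) - P.reg u + inner ℝ (v k (I.xlow k)) (I.xHat a x0 k - u)
      + inner ℝ (blockOp d M (I.xHat a x0 k)) z
      + a.p k / 2 * ‖I.xHat a x0 k - I.xOuter a x0 (k - 1)‖ ^ 2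
  have h3 : a.β k * S = a.β k / a.T k * (a.T k * S) := by
    field_simp
  show a.β k * S + _ ≤ _
  rw [h3, ← mul_add]
  refine mul_le_mul_of_nonneg_left ?_ (by positivity)
  linarith

theorem query_eq (h : IsRun P M a v x0 xlow0 I) {k : ℕ} (hk : 1 ≤ k) (hkN : k ≤ a.N)
    (hτ : 0 ≤ a.τ k) :
    (1 + a.τ k) • I.xlow k = I.xOuter a x0 (k - 1)
      + a.lam k • (I.xHat a x0 (k - 1) - I.xOuter a x0 (k - 2)) + a.τ k • I.xlow (k - 1) := by
  have h1 : (1 + a.τ k) ≠ 0 := by positivity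
  rw [h.xlow_eq k hk hkN, smul_smul, mul_one_div_cancel h1, one_smul]
  rfl

/-- Here `e k` is the linearization at the output minus that at `xlow k`, both evaluated at `xHat
k`. The weighted average of the former is the value at the output, and convexity compares the latter
with `u`. It remains to bound `∑ β_k e_k` by the quadratic terms, which the chain `Φ`, `Ψ` does. -/
theorem smooth_bound (h : IsRun P M a v x0 xlow0 I) (ha : a.Admissible)
    (hc : a.Conditions P.μ P.L ‖blockOp d M‖) (u : Stack V d) :
    (∑ k ∈ Finset.Icc 1 a.N, a.β k) * (P.smooth (I.output a x0) - P.smooth u) ≤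
      ∑ k ∈ Finset.Icc 1 a.N, a.β k * (inner ℝ (P.grad (I.xlow k)) (I.xHat a x0 k - u)
        + a.p k / 4 * ‖I.xHat a x0 k - I.xOuter a x0 (k - 1)‖ ^ 2) := by
  have hout := I.smul_output ha x0
  set y := I.output a x0
  set xh := I.xHat a x0 with hxh
  set xo := I.xOuter a x0 with hxo
  have hN := ha.one_le_N
  have h0 : ∀ k, 1 ≤ k → k ≤ a.N → 0 ≤ a.τ k := fun k hk hkN => hc.τ_nonneg ha P.L.2 hk hkN
  let e : ℕ → ℝ := fun k => P.smooth y + inner ℝ (P.grad y) (xh k - y) - P.smooth (I.xlow k)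
    - inner ℝ (P.grad (I.xlow k)) (xh k - I.xlow k)
  let Φ : ℕ → ℝ := fun k => a.β k * (1 + a.τ k) * P.bregman y (I.xlow k)
    + a.β k * inner ℝ (P.grad (I.xlow k) - P.grad y) (xh k - xo (k - 1))
    + a.β k * (a.p k / 4) * ‖xh k - xo (k - 1)‖ ^ 2
  let Ψ : ℕ → ℝ := fun k => a.β k * a.τ k * P.bregman y (I.xlow (k - 1))
    - a.β k * a.τ k * P.bregman (I.xlow k) (I.xlow (k - 1))
    + a.β k * a.lam k * inner ℝ (P.grad (I.xlow k) - P.grad y) (xh (k - 1) - xo (k - 2))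
  have hchain := sum_add_le_of_chain
    (a := fun k => a.β k * (e k - a.p k / 4 * ‖xh k - xo (k - 1)‖ ^ 2)) (Φ := Φ) (Ψ := Ψ) hN
    (by
      intro k hk hkN
      -- Pairing the recursion for the query points with `∇f̃(xlow_k) - ∇f̃(y)` turns the chain step
      -- into an equality.
      have hq := congrArg (fun x => inner ℝ (P.grad (I.xlow k) - P.grad y) x)
        (h.query_eq hk hkN (h0 k hk hkN))
      simp only [inner_add_right, inner_sub_right, inner_sub_left, real_inner_smul_right,
        ← hxh, ← hxo] at hq
      refine le_of_eq ?_
      simp only [e, Φ, Ψ, LocalData.bregman, inner_sub_right, inner_sub_left]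
      linear_combination (a.β k) * hq)
    (by
      intro k hk hkN
      have hβ := ha.β_pos k (by omega) hkN
      have hβ' := ha.β_pos (k - 1) (by omega) (by omega)
      have hp := ha.p_pos (k - 1) (by omega) (by omega)
      have h1 := hc.β_mul_τ_le k hk hkN
      have h2 := hc.β_eq k hk hkN
      have h3 := hc.L_mul_lam_le k hk hkN
      have hτ := h0 k (by omega) hkN
      -- The two inner products combine to `⟨∇f̃(xlow_k) - ∇f̃(xlow_{k-1}), xHat_{k-1} - x_{k-2}⟩`.
      -- The Bregman term of `Ψ k` and the quarter-weight quadratic of `Φ (k - 1)` pay for it.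
      have h4 := P.abs_inner_grad_sub_le (I.xlow k) (I.xlow (k - 1)) (xh (k - 1) - xo (k - 2))
        (c := a.β (k - 1)) (X := a.β k * a.τ k) (Y := a.β (k - 1) * (a.p (k - 1) / 4)) hβ'.le
        (by positivity) (by positivity) (by
          calc a.β (k - 1) ^ 2 * (2 * P.L) = a.β (k - 1) * a.β k * (2 * P.L * a.lam k) := by
                rw [sq]; nth_rw 2 [h2]; ring
            _ ≤ a.β (k - 1) * a.β k * (a.p (k - 1) * a.τ k) := by gcongr
            _ = _ := by ring)
      have h5 := mul_le_mul_of_nonneg_left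
        (neg_abs_le (inner ℝ (P.grad (I.xlow (k - 1)) - P.grad (I.xlow k))
          (xh (k - 1) - xo (k - 2)))) hβ'.le
      have h6 := mul_le_mul_of_nonneg_right h1 (P.bregman_nonneg y (I.xlow (k - 1)))
      have e1 : k - 1 - 1 = k - 2 := by omega
      simp only [Φ, Ψ, e1, ← h2]
      simp only [inner_sub_left] at h5 h4 ⊢
      linarith)
  -- `τ_1 = 0` removes the Bregman terms, and `xHat_0 = x_{-1} = x_0` removes the extrapolation.
  have hΨ : Ψ 1 = 0 := by
    simp [Ψ, hc.τ_one, hxh, hxo, Iterates.xHat_zero, Iterates.xOuter_zero]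
  have hΦ : 0 ≤ Φ a.N := by
    have hβ := ha.β_pos a.N hN le_rfl
    have hp := ha.p_pos a.N hN le_rfl
    have hτ := h0 a.N hN le_rfl
    have h4 := P.abs_inner_grad_sub_le y (I.xlow a.N) (xh a.N - xo (a.N - 1))
        (c := a.β a.N) (X := a.β a.N * (1 + a.τ a.N)) (Y := a.β a.N * (a.p a.N / 4)) hβ.le
        (by positivity) (by positivity) (by
          calc a.β a.N ^ 2 * (2 * P.L) ≤ a.β a.N ^ 2 * (a.p a.N * (a.τ a.N + 1)) := by
                exact mul_le_mul_of_nonneg_left hc.L_le_last (by positivity)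
            _ = _ := by ring)
    have h5 := mul_le_mul_of_nonneg_left
        (neg_abs_le (inner ℝ (P.grad (I.xlow a.N) - P.grad y) (xh a.N - xo (a.N - 1)))) hβ.le
    simp only [Φ]
    linarith
  have hsum : ∑ k ∈ Finset.Icc 1 a.N, a.β k * inner ℝ (P.grad y) (xh k - y) = 0 := by
    simp only [← real_inner_smul_right]
    rw [← inner_sum]
    simp only [smul_sub]
    rw [Finset.sum_sub_distrib, ← Finset.sum_smul, hout, sub_self, inner_zero_right]
  have hle : ∑ k ∈ Finset.Icc 1 a.N, a.β k * (P.smooth y - P.smooth u) ≤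
      ∑ k ∈ Finset.Icc 1 a.N, (a.β k * (e k - a.p k / 4 * ‖xh k - xo (k - 1)‖ ^ 2)
        - a.β k * inner ℝ (P.grad y) (xh k - y)
        + a.β k * (inner ℝ (P.grad (I.xlow k)) (xh k - u)
          + a.p k / 4 * ‖xh k - xo (k - 1)‖ ^ 2)) := by
    refine Finset.sum_le_sum fun k hk => ?_
    rw [Finset.mem_Icc] at hk
    have hβ := ha.β_pos k hk.1 hk.2
    rw [← mul_sub, ← mul_add]
    gcongr
    have h1 := P.smooth_add_inner_le (I.xlow k) u
    simp only [e, inner_sub_right] at h1 ⊢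
    linarith
  rw [Finset.sum_add_distrib, Finset.sum_sub_distrib, hsum, ← Finset.sum_mul] at hle
  linarith

/-- The error is tested against `u - x_{k-1}` because `xHat_k` depends on `v_k`, whereas `x_{k-1}`
is fixed before the samples of phase `k` are drawn. The remainder `⟨δ_k, xHat_k - x_{k-1}⟩` is
absorbed by completing a square with `p_k/4`. -/
theorem gap_bound (h : IsRun P M a v x0 xlow0 I) (ha : a.Admissible)
    (hc : a.Conditions P.μ P.L ‖blockOp d M‖) {u : Stack V d} (hu : u ∈ P.feasible)
    (hAu : blockOp d M u = 0) (z : Stack κ d) :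
    (∑ k ∈ Finset.Icc 1 a.N, a.β k) * (P.objective (I.output a x0) - P.objective u
      + inner ℝ (blockOp d M (I.output a x0)) z) ≤
    a.β 1 * a.q 1 1 / (2 * a.T 1) * ‖z‖ ^ 2
      + a.β 1 / 2 * (a.η 1 1 / a.T 1 + a.p 1) * ‖x0 - u‖ ^ 2
      + ∑ k ∈ Finset.Icc 1 a.N, a.β k * (‖v k (I.xlow k) - P.grad (I.xlow k)‖ ^ 2 / a.p k
        + inner ℝ (v k (I.xlow k) - P.grad (I.xlow k)) (u - I.xOuter a x0 (k - 1))) := by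
  have h1 := h.composite_bound ha hc hu hAu z
  have h2 := h.smooth_bound ha hc u
  have h3 := h.reg_output_le ha
  have h4 : (∑ k ∈ Finset.Icc 1 a.N, a.β k) * inner ℝ (blockOp d M (I.output a x0)) z =
      ∑ k ∈ Finset.Icc 1 a.N, a.β k * inner ℝ (blockOp d M (I.xHat a x0 k)) z := by
    rw [← real_inner_smul_left, ← map_smul, I.smul_output ha, map_sum, sum_inner]
    exact Finset.sum_congr rfl fun k _ => by rw [map_smul, real_inner_smul_left]
  have h5 : ∑ k ∈ Finset.Icc 1 a.N, (a.β k * P.reg (I.xHat a x0 k) - a.β k * P.reg u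
      + a.β k * inner ℝ (blockOp d M (I.xHat a x0 k)) z
      + a.β k * (inner ℝ (P.grad (I.xlow k)) (I.xHat a x0 k - u)
        + a.p k / 4 * ‖I.xHat a x0 k - I.xOuter a x0 (k - 1)‖ ^ 2)) ≤
      ∑ k ∈ Finset.Icc 1 a.N, (a.β k * (P.reg (I.xHat a x0 k) - P.reg u
        + inner ℝ (v k (I.xlow k)) (I.xHat a x0 k - u) + inner ℝ (blockOp d M (I.xHat a x0 k)) z
        + a.p k / 2 * ‖I.xHat a x0 k - I.xOuter a x0 (k - 1)‖ ^ 2)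
        + a.β k * (‖v k (I.xlow k) - P.grad (I.xlow k)‖ ^ 2 / a.p k
        + inner ℝ (v k (I.xlow k) - P.grad (I.xlow k)) (u - I.xOuter a x0 (k - 1)))) := by
    refine Finset.sum_le_sum fun k hk => ?_
    rw [Finset.mem_Icc] at hk
    have hβ := ha.β_pos k hk.1 hk.2
    have hp := ha.p_pos k hk.1 hk.2
    rw [← mul_sub, ← mul_add, ← mul_add, ← mul_add]
    refine mul_le_mul_of_nonneg_left ?_ hβ.le
    set δ := v k (I.xlow k) - P.grad (I.xlow k) with hδ
    have e1 : v k (I.xlow k) = P.grad (I.xlow k) + δ := by rw [hδ]; abel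
    have e2 : inner ℝ δ (I.xHat a x0 k - u) + inner ℝ δ (u - I.xOuter a x0 (k - 1)) =
        inner ℝ δ (I.xHat a x0 k - I.xOuter a x0 (k - 1)) := by
      rw [← inner_add_right]
      congr 1
      abel
    have e3 : 0 ≤ ‖δ‖ ^ 2 / a.p k + inner ℝ δ (I.xHat a x0 k - I.xOuter a x0 (k - 1))
        + a.p k / 4 * ‖I.xHat a x0 k - I.xOuter a x0 (k - 1)‖ ^ 2 := by
      have f1 := abs_real_inner_le_norm δ (I.xHat a x0 k - I.xOuter a x0 (k - 1))
      have f2 := neg_abs_le (inner ℝ δ (I.xHat a x0 k - I.xOuter a x0 (k - 1)))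
      set m := ‖I.xHat a x0 k - I.xOuter a x0 (k - 1)‖
      have f3 : ‖δ‖ ^ 2 / a.p k - ‖δ‖ * m + a.p k / 4 * m ^ 2 =
          (‖δ‖ - a.p k / 2 * m) ^ 2 / a.p k := by
        field_simp
        ring
      have f4 : 0 ≤ (‖δ‖ - a.p k / 2 * m) ^ 2 / a.p k := by positivity
      linarith
    rw [e1, inner_add_left]
    linarith
  simp only [Finset.sum_add_distrib, Finset.sum_sub_distrib, ← Finset.sum_mul] at h5 h1 h2 ⊢
  rw [P.objective_eq, P.objective_eq, mul_add, h4]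
  linarith

end IsRun

/-! ### Square integrable adapted vectors -/

section SquareIntegrable

variable {Ω : Type*} {mΩ : MeasurableSpace Ω} {prob : Measure Ω}
  {E : Type*} [NormedAddCommGroup E] [MeasurableSpace E]
  {E' : Type*} [NormedAddCommGroup E'] [MeasurableSpace E']

theorem memLp_comp_of_lipschitz {F F' : Type*} [NormedAddCommGroup F] [NormedAddCommGroup F']
    [IsFiniteMeasure prob] {Φ : F → F'} {C : ℝ≥0} (hΦ : LipschitzWith C Φ) {f : Ω → F}
    (hf : MemLp f 2 prob) : MemLp (fun ω => Φ (f ω)) 2 prob := by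
  have h1 : LipschitzWith C (fun x => Φ x - Φ 0) :=
    LipschitzWith.of_dist_le_mul fun x y => by simpa using hΦ.dist_le_mul x y
  have h2 : (fun ω => Φ (f ω)) = ((fun x => Φ x - Φ 0) ∘ f) + fun _ => Φ 0 := by
    funext ω
    simp
  rw [h2]
  exact (h1.comp_memLp (sub_self _) hf).add (memLp_const (Φ 0))

/-- Square integrable random vectors that are measurable with respect to a given `σ`-algebra. -/
def SqAdapted (m : MeasurableSpace Ω) (prob : @Measure Ω mΩ) (f : Ω → E) : Prop :=
  Measurable[m] f ∧ MemLp f 2 prob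

namespace SqAdapted

variable {m m' : MeasurableSpace Ω} {f g : Ω → E}

theorem mono (hf : SqAdapted m prob f) (h : m ≤ m') : SqAdapted m' prob f :=
  ⟨hf.1.mono h le_rfl, hf.2⟩

theorem const [IsFiniteMeasure prob] (c : E) : SqAdapted m prob (fun _ => c) :=
  ⟨measurable_const, memLp_const c⟩

theorem add [SecondCountableTopology E] [BorelSpace E] (hf : SqAdapted m prob f)
    (hg : SqAdapted m prob g) : SqAdapted m prob (fun ω => f ω + g ω) :=
  ⟨hf.1.add hg.1, hf.2.add hg.2⟩

theorem sub [SecondCountableTopology E] [BorelSpace E] (hf : SqAdapted m prob f)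
    (hg : SqAdapted m prob g) : SqAdapted m prob (fun ω => f ω - g ω) :=
  ⟨hf.1.sub hg.1, hf.2.sub hg.2⟩

theorem const_smul [NormedSpace ℝ E] [BorelSpace E] (hf : SqAdapted m prob f) (c : ℝ) :
    SqAdapted m prob (fun ω => c • f ω) :=
  ⟨hf.1.const_smul c, hf.2.const_smul c⟩

theorem sum [SecondCountableTopology E] [BorelSpace E] {ι : Type*} (s : Finset ι) {F : ι → Ω → E}
    (hF : ∀ i ∈ s, SqAdapted m prob (F i)) : SqAdapted m prob (fun ω => ∑ i ∈ s, F i ω) :=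
  ⟨Finset.measurable_sum s fun i hi => (hF i hi).1, memLp_finsetSum s fun i hi => (hF i hi).2⟩

theorem lipschitz [IsFiniteMeasure prob] [BorelSpace E] [BorelSpace E'] {Φ : E → E'} {C : ℝ≥0}
    (hΦ : LipschitzWith C Φ) (hf : SqAdapted m prob f) :
    SqAdapted m prob (fun ω => Φ (f ω)) :=
  ⟨hΦ.continuous.measurable.comp hf.1, memLp_comp_of_lipschitz hΦ hf.2⟩

theorem clm [NormedSpace ℝ E] [NormedSpace ℝ E'] [IsFiniteMeasure prob] [BorelSpace E]
    [BorelSpace E'] (A : E →L[ℝ] E') (hf : SqAdapted m prob f) :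
    SqAdapted m prob (fun ω => A (f ω)) := hf.lipschitz A.lipschitz

/-- The bound over pairs of outcomes makes `h` factor through a Lipschitz function on the range of
`f`. Its Lipschitz extension to the whole space is measurable, so no measurability of `h` is needed
beforehand. -/
theorem of_norm_sub_le [NormedSpace ℝ E'] [FiniteDimensional ℝ E'] [IsFiniteMeasure prob]
    [BorelSpace E] [BorelSpace E'] {h : Ω → E'} (hf : SqAdapted m prob f) (C : ℝ≥0)
    (hle : ∀ ω ω', ‖h ω - h ω'‖ ≤ C * ‖f ω - f ω'‖) : SqAdapted m prob h := by
  rcases isEmpty_or_nonempty Ω with hΩ | hΩ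
  · rw [Subsingleton.elim h fun _ => 0]
    exact const 0
  have hinv : ∀ e ∈ Set.range f, ∃ ω, f ω = e := fun e he => he
  choose! r hr using hinv
  have h1 : LipschitzOnWith C (fun e => h (r e)) (Set.range f) := by
    refine LipschitzOnWith.of_dist_le_mul fun e he e' he' => ?_
    have := hle (r e) (r e')
    rwa [hr e he, hr e' he', ← dist_eq_norm, ← dist_eq_norm] at this
  obtain ⟨Φ, hΦ, heq⟩ := h1.extend_finite_dimension
  have h2 : h = fun ω => Φ (f ω) := by
    funext ω
    have h3 : ‖h ω - h (r (f ω))‖ ≤ 0 := by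
      simpa [hr (f ω) (Set.mem_range_self ω)] using hle ω (r (f ω))
    rw [← heq (Set.mem_range_self ω)]
    exact sub_eq_zero.1 (norm_le_zero_iff.1 h3)
  rw [h2]
  exact hf.lipschitz hΦ

theorem integrable_norm_sq (hf : SqAdapted m prob f) : Integrable (fun ω => ‖f ω‖ ^ 2) prob :=
  hf.2.integrable_norm_pow two_ne_zero

end SqAdapted

theorem _root_.MeasureTheory.MemLp.integrable_real_inner {F : Type*} [NormedAddCommGroup F]
    [InnerProductSpace ℝ F] {f g : Ω → F} (hf : MemLp f 2 prob) (hg : MemLp g 2 prob) :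
    Integrable (fun ω => inner ℝ (f ω) (g ω)) prob := by
  refine (hf.norm.integrable_mul hg.norm).mono' (hf.1.inner hg.1) ?_
  filter_upwards with ω using norm_inner_le_norm _ _

end SquareIntegrable

/-! ### Independence and freezing of past variables -/

section Samples

variable {Ω : Type*} {mΩ : MeasurableSpace Ω} {prob : Measure Ω} {ι S : Type*}
  [MeasurableSpace S] {X : ι → Ω → S}

/-- The `σ`-algebra generated by the variables with index in `s`. -/
abbrev generated (X : ι → Ω → S) (s : Set ι) : MeasurableSpace Ω :=
  ⨆ i ∈ s, MeasurableSpace.comap (X i) inferInstance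

theorem generated_mono {s t : Set ι} (h : s ⊆ t) : generated X s ≤ generated X t :=
  biSup_mono h

theorem generated_le (hX : ∀ i, Measurable (X i)) (s : Set ι) : generated X s ≤ mΩ :=
  iSup₂_le fun i _ => (hX i).comap_le

theorem measurable_generated {s : Set ι} {i : ι} (hi : i ∈ s) : Measurable[generated X s] (X i) :=
  Measurable.mono (comap_measurable (X i))
    (le_iSup₂ (f := fun i (_ : i ∈ s) => MeasurableSpace.comap (X i) inferInstance) i hi) le_rfl

theorem indepFun_of_generated (hX : ∀ i, Measurable (X i)) (hind : iIndepFun X prob)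
    {α β : Type*} [MeasurableSpace α] [MeasurableSpace β] {s : Set ι} {i : ι} (hi : i ∉ s)
    {Y : Ω → α} (hY : Measurable[generated X s] Y) {φ : S → β} (hφ : Measurable φ) :
    IndepFun Y (fun ω => φ (X i ω)) prob := by
  have h1 := indep_iSup_of_disjoint (fun j => (hX j).comap_le) ((iIndepFun_iff_iIndep _ _ _).1 hind)
    (Set.disjoint_singleton_right.2 hi)
  rw [IndepFun_iff_Indep]
  refine indep_of_indep_of_le_right (indep_of_indep_of_le_left h1 hY.comap_le) ?_
  exact (hφ.comp (measurable_generated (Set.mem_singleton i))).comap_le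

variable [IsProbabilityMeasure prob] {α β : Type*} [MeasurableSpace α] [MeasurableSpace β]
  {Y : Ω → α} {Z : Ω → β}

theorem lintegral_of_indepFun (hY : Measurable Y) (hZ : Measurable Z) (h : IndepFun Y Z prob)
    {F : α → β → ENNReal} (hF : Measurable (Function.uncurry F)) :
    ∫⁻ ω, F (Y ω) (Z ω) ∂prob = ∫⁻ ω, ∫⁻ s, F (Y ω) s ∂(prob.map Z) ∂prob := by
  have := Measure.isProbabilityMeasure_map hZ.aemeasurable (μ := prob)
  have := Measure.isProbabilityMeasure_map hY.aemeasurable (μ := prob)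
  calc ∫⁻ ω, F (Y ω) (Z ω) ∂prob
      = ∫⁻ p, Function.uncurry F p ∂(prob.map (fun ω => (Y ω, Z ω))) :=
        (lintegral_map hF (hY.prodMk hZ)).symm
    _ = ∫⁻ y, ∫⁻ s, F y s ∂(prob.map Z) ∂(prob.map Y) := by
        rw [h.map_prod_eq_prod_map_map hY.aemeasurable hZ.aemeasurable,
          lintegral_prod _ hF.aemeasurable]
        rfl
    _ = _ := lintegral_map hF.lintegral_prod_right hY

theorem integral_of_indepFun (hY : Measurable Y) (hZ : Measurable Z) (h : IndepFun Y Z prob)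
    {F : α → β → ℝ} (hF : Measurable (Function.uncurry F))
    (hint : Integrable (fun ω => F (Y ω) (Z ω)) prob) :
    ∫ ω, F (Y ω) (Z ω) ∂prob = ∫ ω, ∫ s, F (Y ω) s ∂(prob.map Z) ∂prob := by
  have := Measure.isProbabilityMeasure_map hZ.aemeasurable (μ := prob)
  have := Measure.isProbabilityMeasure_map hY.aemeasurable (μ := prob)
  have h1 := (integrable_map_measure (f := fun ω => (Y ω, Z ω)) (g := Function.uncurry F)
    hF.aestronglyMeasurable (hY.prodMk hZ).aemeasurable).2 hint
  rw [h.map_prod_eq_prod_map_map hY.aemeasurable hZ.aemeasurable] at h1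
  calc ∫ ω, F (Y ω) (Z ω) ∂prob
      = ∫ p, Function.uncurry F p ∂(prob.map (fun ω => (Y ω, Z ω))) :=
        (integral_map (hY.prodMk hZ).aemeasurable hF.aestronglyMeasurable).symm
    _ = ∫ y, ∫ s, F y s ∂(prob.map Z) ∂(prob.map Y) := by
        rw [h.map_prod_eq_prod_map_map hY.aemeasurable hZ.aemeasurable, integral_prod _ h1]
        rfl
    _ = _ := integral_map hY.aemeasurable
        hF.stronglyMeasurable.integral_prod_right.aestronglyMeasurable

end Samples

section SampleAlgebra

theorem measurable_stack_apply {W : Type*} {d : ℕ} (i : W) : Measurable fun y : Stack W d => y i :=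
  (measurable_pi_apply i).comp (WithLp.measurable_ofLp 2 _)

variable {V : Type*} {Ξ : V → Type*} [∀ i, MeasurableSpace (Ξ i)] {Ω : Type*}
  {ξ : ℕ → ℕ → Ω → ∀ i, Ξ i}

/-- The `σ`-algebra generated by the network-wide samples with index in `S`. -/
abbrev sampleAlgebra (ξ : ℕ → ℕ → Ω → ∀ i, Ξ i) (S : Set (ℕ × ℕ)) : MeasurableSpace Ω :=
  generated (fun s : ℕ × ℕ => ξ s.1 s.2) S

theorem measurable_sampleAlgebra {S : Set (ℕ × ℕ)} {k j : ℕ} (h : (k, j) ∈ S) :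
    Measurable[sampleAlgebra ξ S] (ξ k j) :=
  measurable_generated (X := fun s : ℕ × ℕ => ξ s.1 s.2) h

theorem sampleAlgebra_mono {k l : ℕ} (h : k ≤ l) :
    sampleAlgebra ξ {s | s.1 < k} ≤ sampleAlgebra ξ {s | s.1 < l} :=
  generated_mono fun _ hs => lt_of_lt_of_le hs h

end SampleAlgebra

/-! ### Moments of the oracle error -/

section Noise

variable {V : Type*} [Fintype V] {d : ℕ} {P : LocalData V d} {Ξ : V → Type*}
  [∀ i, MeasurableSpace (Ξ i)] {σ : ℝ}

/-- The stacked error of the oracle at the query point `y`, for the network-wide sample `s`. -/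
def Oracle.noise (O : Oracle P Ξ σ) (s : ∀ i, Ξ i) (y : Stack V d) : Stack V d :=
  WithLp.toLp 2 fun i => O.G i (y i) (s i) - gradient (P.fs i) (y i)

theorem Oracle.noise_apply (O : Oracle P Ξ σ) (s : ∀ i, Ξ i) (y : Stack V d) (i : V) :
    O.noise s y i = O.G i (y i) (s i) - gradient (P.fs i) (y i) := rfl

theorem Oracle.miniBatch_sub_grad (O : Oracle P Ξ σ) {c : ℕ} (hc : 1 ≤ c) (s : ℕ → ∀ i, Ξ i)
    (y : Stack V d) :
    O.miniBatch c s y - P.grad y = (1 / (c : ℝ)) • ∑ j ∈ Finset.Icc 1 c, O.noise (s j) y := by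
  have hc' : (c : ℝ) ≠ 0 := by positivity
  ext1 i
  rw [PiLp.sub_apply, PiLp.smul_apply, WithLp.ofLp_sum, Finset.sum_apply]
  simp only [noise_apply, Finset.sum_sub_distrib, smul_sub, Finset.sum_const, Nat.card_Icc,
    Nat.add_sub_cancel, ← Nat.cast_smul_eq_nsmul ℝ, smul_smul, one_div_mul_cancel hc', one_smul]
  rfl

theorem LocalData.lipschitz_grad (P : LocalData V d) : LipschitzWith P.L P.grad := by
  refine LipschitzWith.of_dist_le_mul fun x y => ?_
  rw [dist_eq_norm, dist_eq_norm]
  refine (abs_le_of_sq_le_sq' ?_ (by positivity)).2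
  rw [mul_pow, PiLp.norm_sq_eq_of_L2, PiLp.norm_sq_eq_of_L2, Finset.mul_sum]
  refine Finset.sum_le_sum fun i _ => ?_
  rw [← mul_pow]
  gcongr
  exact (P.lipschitz_gradient_fs i).norm_sub_le (x i) (y i)

theorem Oracle.measurable_noise_apply (O : Oracle P Ξ σ) (i : V) :
    Measurable (Function.uncurry fun (y : EuclideanSpace ℝ (Fin d)) (s : Ξ i) =>
      O.G i y s - gradient (P.fs i) y) :=
  (O.measurable_G i).sub ((P.lipschitz_gradient_fs i).continuous.measurable.comp measurable_fst)

variable {Ω : Type*} {mΩ : MeasurableSpace Ω} {prob : Measure Ω} {ξ : ℕ → ℕ → Ω → ∀ i, Ξ i}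

theorem Oracle.measurable_noise (O : Oracle P Ξ σ) {m : MeasurableSpace Ω} {X : Ω → ∀ i, Ξ i}
    {Y : Ω → Stack V d} (hX : Measurable[m] X) (hY : Measurable[m] Y) :
    Measurable[m] fun ω => O.noise (X ω) (Y ω) := by
  refine (WithLp.measurable_toLp 2 _).comp (measurable_pi_lambda _ fun i => ?_)
  exact (O.measurable_noise_apply i).comp
    (((measurable_stack_apply i).comp hY).prodMk ((measurable_pi_apply i).comp hX))

variable {O : Oracle P Ξ σ}

theorem IsSampling.sampleAlgebra_le (hξ : IsSampling O prob ξ) (S : Set (ℕ × ℕ)) :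
    sampleAlgebra ξ S ≤ mΩ :=
  generated_le (X := fun s : ℕ × ℕ => ξ s.1 s.2) (fun s => hξ.measurable s.1 s.2) S

theorem IsSampling.indepFun (hξ : IsSampling O prob ξ) {S : Set (ℕ × ℕ)} {k j : ℕ}
    (h : (k, j) ∉ S) {α : Type*} [MeasurableSpace α] {Y : Ω → α}
    (hY : Measurable[sampleAlgebra ξ S] Y) (i : V) : IndepFun Y (fun ω => ξ k j ω i) prob :=
  indepFun_of_generated (fun s : ℕ × ℕ => hξ.measurable s.1 s.2) hξ.indep h hY
    (measurable_pi_apply i)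

variable [IsProbabilityMeasure prob]

theorem IsSampling.lintegral_sample (hξ : IsSampling O prob ξ) {S : Set (ℕ × ℕ)} {k j : ℕ}
    (h : (k, j) ∉ S) {α : Type*} [MeasurableSpace α] {Y : Ω → α}
    (hY : Measurable[sampleAlgebra ξ S] Y) (i : V) {F : α → Ξ i → ENNReal}
    (hF : Measurable (Function.uncurry F)) :
    Measurable (fun ω => F (Y ω) (ξ k j ω i)) ∧
    Measurable (fun ω => ∫⁻ s, F (Y ω) s ∂(O.law i)) ∧
    ∫⁻ ω, F (Y ω) (ξ k j ω i) ∂prob = ∫⁻ ω, ∫⁻ s, F (Y ω) s ∂(O.law i) ∂prob := by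
  have hY' : Measurable Y := hY.mono (hξ.sampleAlgebra_le S) le_rfl
  have hi : Measurable fun ω => ξ k j ω i := (measurable_pi_apply i).comp (hξ.measurable k j)
  have hlaw := O.isProbabilityMeasure_law i
  refine ⟨hF.comp (hY'.prodMk hi), hF.lintegral_prod_right.comp hY', ?_⟩
  rw [← hξ.map_eq k j i]
  exact lintegral_of_indepFun hY' hi (hξ.indepFun h hY i) hF

/-- Only the law of each single agent is known, so independence is applied block by block. Summing
over agents before the last estimate brings in the stacked variance bound. Extended nonnegative
integrals avoid presupposing integrability. -/
theorem IsSampling.noise_moment (hξ : IsSampling O prob ξ) {S : Set (ℕ × ℕ)} {k j : ℕ}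
    (h : (k, j) ∉ S) {Y : Ω → Stack V d} (hY : Measurable[sampleAlgebra ξ S] Y)
    (hdom : ∀ᵐ ω ∂prob, ∀ i, Y ω i ∈ O.queryDomain i) :
    MemLp (fun ω => O.noise (ξ k j ω) (Y ω)) 2 prob ∧
      ∫ ω, ‖O.noise (ξ k j ω) (Y ω)‖ ^ 2 ∂prob ≤ σ ^ 2 := by
  have hY' : Measurable Y := hY.mono (hξ.sampleAlgebra_le S) le_rfl
  have hmeas := O.measurable_noise (hξ.measurable k j) hY'
  have hF := fun i => hξ.lintegral_sample h (Y := fun ω => Y ω i)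
    ((measurable_stack_apply i).comp hY) i
    (F := fun y s => ENNReal.ofReal (‖O.G i y s - gradient (P.fs i) y‖ ^ 2))
    ((O.measurable_noise_apply i).norm.pow_const 2).ennreal_ofReal
  have hlint : ∫⁻ ω, ENNReal.ofReal (‖O.noise (ξ k j ω) (Y ω)‖ ^ 2) ∂prob ≤
      ENNReal.ofReal (σ ^ 2) := by
    calc ∫⁻ ω, ENNReal.ofReal (‖O.noise (ξ k j ω) (Y ω)‖ ^ 2) ∂prob
        = ∫⁻ ω, ∑ i, ENNReal.ofReal (‖O.G i (Y ω i) (ξ k j ω i)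
            - gradient (P.fs i) (Y ω i)‖ ^ 2) ∂prob := by
          refine lintegral_congr fun ω => ?_
          rw [PiLp.norm_sq_eq_of_L2, ENNReal.ofReal_sum_of_nonneg fun i _ => sq_nonneg _]
          rfl
      _ = ∑ i, ∫⁻ ω, ENNReal.ofReal (‖O.G i (Y ω i) (ξ k j ω i)
            - gradient (P.fs i) (Y ω i)‖ ^ 2) ∂prob :=
          lintegral_finsetSum _ fun i _ => (hF i).1
      _ = ∑ i, ∫⁻ ω, ∫⁻ s, ENNReal.ofReal (‖O.G i (Y ω i) s
            - gradient (P.fs i) (Y ω i)‖ ^ 2) ∂(O.law i) ∂prob :=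
          Finset.sum_congr rfl fun i _ => (hF i).2.2
      _ = ∫⁻ ω, ∑ i, ∫⁻ s, ENNReal.ofReal (‖O.G i (Y ω i) s
            - gradient (P.fs i) (Y ω i)‖ ^ 2) ∂(O.law i) ∂prob :=
          (lintegral_finsetSum _ fun i _ => (hF i).2.1).symm
      _ ≤ ∫⁻ _, ENNReal.ofReal (σ ^ 2) ∂prob := by
          refine lintegral_mono_ae ?_
          filter_upwards [hdom] with ω hω
          refine le_trans (le_of_eq ?_) (ENNReal.ofReal_le_ofReal (O.variance_le (Y ω) hω))
          rw [ENNReal.ofReal_sum_of_nonneg fun i _ => integral_nonneg fun s => sq_nonneg _]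
          refine Finset.sum_congr rfl fun i _ => ?_
          rw [ofReal_integral_eq_lintegral_ofReal (O.integrable_sq i _ (hω i))]
          filter_upwards with s using sq_nonneg _
      _ = _ := by simp
  have hsq : Measurable fun ω => ‖O.noise (ξ k j ω) (Y ω)‖ ^ 2 := hmeas.norm.pow_const 2
  refine ⟨(memLp_two_iff_integrable_sq_norm hmeas.aestronglyMeasurable).2
    ⟨hsq.aestronglyMeasurable, ?_⟩, ?_⟩
  · rw [hasFiniteIntegral_iff_ofReal (by filter_upwards with ω using sq_nonneg _)]
    exact hlint.trans_lt ENNReal.ofReal_lt_top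
  · rw [integral_eq_lintegral_of_nonneg_ae (by filter_upwards with ω using sq_nonneg _)
      hsq.aestronglyMeasurable]
    exact ENNReal.toReal_le_of_le_ofReal (sq_nonneg σ) hlint

/-- The query point and the test vector are both determined by other samples. They can be frozen
together, after which unbiasedness makes the inner integral vanish. -/
theorem IsSampling.integral_inner_noise (hξ : IsSampling O prob ξ) {S : Set (ℕ × ℕ)} {k j : ℕ}
    (h : (k, j) ∉ S) {Y W : Ω → Stack V d} (hY : Measurable[sampleAlgebra ξ S] Y)
    (hdom : ∀ᵐ ω ∂prob, ∀ i, Y ω i ∈ O.queryDomain i)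
    (hW : SqAdapted (sampleAlgebra ξ S) prob W) :
    ∫ ω, inner ℝ (O.noise (ξ k j ω) (Y ω)) (W ω) ∂prob = 0 := by
  have hY' : Measurable Y := hY.mono (hξ.sampleAlgebra_le S) le_rfl
  have hW' : Measurable W := hW.1.mono (hξ.sampleAlgebra_le S) le_rfl
  have hD := (hξ.noise_moment h hY hdom).1
  have hlaw := O.isProbabilityMeasure_law
  have hint : ∀ i, Integrable (fun ω => inner ℝ (O.noise (ξ k j ω) (Y ω) i) (W ω i)) prob :=
    fun i => (((PiLp.proj 2 (𝕜 := ℝ) (fun _ : V => EuclideanSpace ℝ (Fin d)) i).comp_memLp'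
      hD).integrable_real_inner ((PiLp.proj 2 (𝕜 := ℝ)
        (fun _ : V => EuclideanSpace ℝ (Fin d)) i).comp_memLp' hW.2))
  simp only [PiLp.inner_apply (𝕜 := ℝ) (f := fun _ : V => EuclideanSpace ℝ (Fin d))]
  rw [integral_finsetSum _ fun i _ => hint i]
  refine Finset.sum_eq_zero fun i _ => ?_
  have hpair : Measurable[sampleAlgebra ξ S] fun ω => (Y ω i, W ω i) :=
    ((measurable_stack_apply i).comp hY).prodMk ((measurable_stack_apply i).comp hW.1)
  have hF : Measurable (Function.uncurry
      fun (y : EuclideanSpace ℝ (Fin d) × EuclideanSpace ℝ (Fin d)) (s : Ξ i) =>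
        inner ℝ (O.G i y.1 s - gradient (P.fs i) y.1) y.2) :=
    ((O.measurable_noise_apply i).comp ((measurable_fst.comp measurable_fst).prodMk
      measurable_snd)).inner (measurable_snd.comp measurable_fst)
  have h1 := integral_of_indepFun (hpair.mono (hξ.sampleAlgebra_le S) le_rfl)
    ((measurable_pi_apply i).comp (hξ.measurable k j)) (hξ.indepFun h hpair i) hF (hint i)
  refine h1.trans (integral_eq_zero_of_ae ?_)
  filter_upwards [hdom] with ω hω
  have h2 := O.unbiased i (Y ω i) (hω i)
  have h3 : Integrable (fun s => O.G i (Y ω i) s - gradient (P.fs i) (Y ω i)) (O.law i) :=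
    h2.1.sub (integrable_const _)
  have h4 : prob.map ((fun f : ∀ i, Ξ i => f i) ∘ ξ k j) = O.law i := hξ.map_eq k j i
  simp only [h4, Pi.zero_apply]
  simp only [real_inner_comm (W ω i)]
  rw [integral_inner h3, integral_sub h2.1 (integrable_const _), h2.2]
  simp

/-- Induction on the batch size: the earlier errors of the same batch serve as test vector for the
new one, so the cross term has mean zero and variances add. -/
theorem IsSampling.sum_noise_moment (hξ : IsSampling O prob ξ) {k : ℕ} {Y : Ω → Stack V d}
    (hY : Measurable[sampleAlgebra ξ {s | s.1 < k}] Y)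
    (hdom : ∀ᵐ ω ∂prob, ∀ i, Y ω i ∈ O.queryDomain i) (c : ℕ) :
    SqAdapted (sampleAlgebra ξ {s | s.1 < k ∨ s.1 = k ∧ s.2 ≤ c}) prob
      (fun ω => ∑ j ∈ Finset.Icc 1 c, O.noise (ξ k j ω) (Y ω)) ∧
    ∫ ω, ‖∑ j ∈ Finset.Icc 1 c, O.noise (ξ k j ω) (Y ω)‖ ^ 2 ∂prob ≤ c * σ ^ 2 := by
  have hY' : ∀ c, Measurable[sampleAlgebra ξ {s | s.1 < k ∨ s.1 = k ∧ s.2 ≤ c}] Y := fun c =>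
    hY.mono (generated_mono fun s hs => Or.inl hs) le_rfl
  induction c with
  | zero => simpa using SqAdapted.const (0 : Stack V d)
  | succ c ih =>
    have hnot : (k, c + 1) ∉ {s : ℕ × ℕ | s.1 < k ∨ s.1 = k ∧ s.2 ≤ c} := by simp
    have h1 := hξ.noise_moment hnot (hY' c) hdom
    have h2 := hξ.integral_inner_noise hnot (hY' c) hdom ih.1
    have h3 : SqAdapted (sampleAlgebra ξ {s | s.1 < k ∨ s.1 = k ∧ s.2 ≤ c + 1}) prob
        (fun ω => O.noise (ξ k (c + 1) ω) (Y ω)) :=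
      ⟨O.measurable_noise (measurable_sampleAlgebra (by simp)) (hY' (c + 1)), h1.1⟩
    have hsplit : ∀ ω, ∑ j ∈ Finset.Icc 1 (c + 1), O.noise (ξ k j ω) (Y ω) =
        O.noise (ξ k (c + 1) ω) (Y ω) + ∑ j ∈ Finset.Icc 1 c, O.noise (ξ k j ω) (Y ω) := by
      intro ω
      rw [Finset.sum_Icc_succ_top (by omega), add_comm]
    simp only [hsplit]
    refine ⟨h3.add (ih.1.mono (generated_mono fun s hs => ?_)), ?_⟩
    · exact hs.imp_right fun h => ⟨h.1, by omega⟩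
    simp only [norm_add_sq_real]
    have i1 := h3.integrable_norm_sq
    have i2 := (h1.1.integrable_real_inner ih.1.2).const_mul 2
    rw [integral_add (by exact i1.add i2) ih.1.integrable_norm_sq, integral_add i1 i2,
      integral_const_mul, h2]
    push_cast
    linarith [h1.2, ih.2]

theorem IsSampling.miniBatch_error (hξ : IsSampling O prob ξ) {k c : ℕ} (hc : 1 ≤ c)
    {Y : Ω → Stack V d} (hY : Measurable[sampleAlgebra ξ {s | s.1 < k}] Y)
    (hdom : ∀ᵐ ω ∂prob, ∀ i, Y ω i ∈ O.queryDomain i) :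
    SqAdapted (sampleAlgebra ξ {s | s.1 < k + 1}) prob
      (fun ω => O.miniBatch c (fun j => ξ k j ω) (Y ω) - P.grad (Y ω)) ∧
    ∫ ω, ‖O.miniBatch c (fun j => ξ k j ω) (Y ω) - P.grad (Y ω)‖ ^ 2 ∂prob ≤ σ ^ 2 / c := by
  have hc' : (0 : ℝ) < c := by positivity
  have h1 := hξ.sum_noise_moment hY hdom c
  simp only [O.miniBatch_sub_grad hc]
  refine ⟨(h1.1.mono (generated_mono fun s hs => ?_)).const_smul _, ?_⟩
  · rcases hs with hs | hs
    · exact Nat.lt_succ_of_lt hs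
    · exact Nat.lt_succ_of_le hs.1.le
  · simp only [norm_smul, mul_pow]
    rw [integral_const_mul, Real.norm_of_nonneg (by positivity)]
    calc (1 / (c : ℝ)) ^ 2 * ∫ ω, ‖∑ j ∈ Finset.Icc 1 c, O.noise (ξ k j ω) (Y ω)‖ ^ 2 ∂prob
        ≤ (1 / (c : ℝ)) ^ 2 * (c * σ ^ 2) := by gcongr; exact h1.2
      _ = σ ^ 2 / c := by field_simp

theorem IsSampling.sqAdapted_miniBatch (hξ : IsSampling O prob ξ) {k c : ℕ} (hc : 1 ≤ c)
    {Y : Ω → Stack V d} (hY : SqAdapted (sampleAlgebra ξ {s | s.1 < k}) prob Y)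
    (hdom : ∀ᵐ ω ∂prob, ∀ i, Y ω i ∈ O.queryDomain i) :
    SqAdapted (sampleAlgebra ξ {s | s.1 < k + 1}) prob
      fun ω => O.miniBatch c (fun j => ξ k j ω) (Y ω) := by
  have h := (hY.mono (sampleAlgebra_mono (ξ := ξ) k.le_succ)).lipschitz P.lipschitz_grad
  simpa using (hξ.miniBatch_error hc hY.1 hdom).1.add h

theorem IsSampling.integral_inner_miniBatch_error (hξ : IsSampling O prob ξ) {k c : ℕ}
    (hc : 1 ≤ c) {Y W : Ω → Stack V d} (hY : Measurable[sampleAlgebra ξ {s | s.1 < k}] Y)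
    (hdom : ∀ᵐ ω ∂prob, ∀ i, Y ω i ∈ O.queryDomain i)
    (hW : SqAdapted (sampleAlgebra ξ {s | s.1 < k}) prob W) :
    ∫ ω, inner ℝ (O.miniBatch c (fun j => ξ k j ω) (Y ω) - P.grad (Y ω)) (W ω) ∂prob = 0 := by
  have hnot : ∀ j, (k, j) ∉ {s : ℕ × ℕ | s.1 < k} := by simp
  simp only [O.miniBatch_sub_grad hc, real_inner_smul_left, sum_inner]
  rw [integral_const_mul, integral_finsetSum _ fun j _ =>
    (hξ.noise_moment (hnot j) hY hdom).1.integrable_real_inner hW.2]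
  simp only [hξ.integral_inner_noise (hnot _) hY hdom hW, Finset.sum_const_zero, mul_zero]

end Noise

/-! ### Adaptedness of the iterates -/

section Adapted

variable {V κ : Type*} {d : ℕ} [Fintype V] [Fintype κ] {P : LocalData V d} {M : Matrix κ V ℝ}
  {a : Params} {x0 xlow0 : Stack V d}

theorem IsRun.norm_x_sub_le {v v' : ℕ → Stack V d → Stack V d} {I I' : Iterates V κ d}
    (h : IsRun P M a v x0 xlow0 I) (h' : IsRun P M a v' x0 xlow0 I') {k t : ℕ} (hk : 1 ≤ k)
    (hkN : k ≤ a.N) (ht : 1 ≤ t) (htT : t ≤ a.T k) (hη : 0 ≤ a.η k t) (hp : 0 < a.p k) :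
    ‖I.x k t - I'.x k t‖ ≤ (a.p k)⁻¹ *
      ‖(v k (I.xlow k) + blockOp d M.transpose (I.z k t) - a.η k t • I.x k (t - 1)
          - a.p k • I.xOuter a x0 (k - 1))
        - (v' k (I'.xlow k) + blockOp d M.transpose (I'.z k t) - a.η k t • I'.x k (t - 1)
          - a.p k • I'.xOuter a x0 (k - 1))‖ := by
  refine (abs_le_of_sq_le_sq' ?_ (by positivity)).2
  rw [mul_pow, PiLp.norm_sq_eq_of_L2, PiLp.norm_sq_eq_of_L2, Finset.mul_sum]
  refine Finset.sum_le_sum fun i _ => ?_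
  rw [← mul_pow]
  gcongr
  exact prox_norm_sub_le (P.strongConvexOn_ν i) P.μ_nonneg hη hp
    (h.x_mem k hk hkN t ht htT i) (h'.x_mem k hk hkN t ht htT i)
    (h.x_step k hk hkN t ht htT i) (h'.x_step k hk hkN t ht htT i)

variable {Ξ : V → Type*} [∀ i, MeasurableSpace (Ξ i)] {σ : ℝ} {O : Oracle P Ξ σ}
  {Ω : Type*} {mΩ : MeasurableSpace Ω} {prob : Measure Ω}
  {ξ : ℕ → ℕ → Ω → ∀ i, Ξ i} {I : Ω → Iterates V κ d}

/-- The iterates of phase `k` are square integrable and determined by the samples of the phases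
up to `k`. -/
structure PhaseAdapted (a : Params) (x0 : Stack V d) (prob : Measure Ω)
    (ξ : ℕ → ℕ → Ω → ∀ i, Ξ i) (I : Ω → Iterates V κ d) (k : ℕ) : Prop where
  xlow : SqAdapted (sampleAlgebra ξ {s | s.1 < k + 1}) prob fun ω => (I ω).xlow k
  zOuter : SqAdapted (sampleAlgebra ξ {s | s.1 < k + 1}) prob fun ω => (I ω).zOuter a k
  xOuter : SqAdapted (sampleAlgebra ξ {s | s.1 < k + 1}) prob fun ω => (I ω).xOuter a x0 k
  xHat : SqAdapted (sampleAlgebra ξ {s | s.1 < k + 1}) prob fun ω => (I ω).xHat a x0 k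
  x : 1 ≤ k → ∀ t ≤ a.T k,
    SqAdapted (sampleAlgebra ξ {s | s.1 < k + 1}) prob fun ω => (I ω).x k t

theorem xlow_adapted
    (hrun : ∀ ω, IsRun P M a (fun k => O.miniBatch (a.c k) (fun j => ξ k j ω)) x0 xlow0 (I ω))
    {k : ℕ} (hk : 1 ≤ k) (hkN : k ≤ a.N) (ih : ∀ l < k, PhaseAdapted a x0 prob ξ I l) :
    SqAdapted (sampleAlgebra ξ {s | s.1 < k}) prob fun ω => (I ω).xlow k := by
  have h1 := ih (k - 1) (by omega)
  have h2 := ih (k - 2) (by omega)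
  have e1 : k - 1 + 1 ≤ k := by omega
  have e2 : k - 2 + 1 ≤ k := by omega
  simp only [fun ω => (hrun ω).xlow_eq k hk hkN, Iterates.xTilde]
  exact ((((h1.xOuter.mono (sampleAlgebra_mono e1)).add
    (((h1.xHat.mono (sampleAlgebra_mono e1)).sub
      (h2.xOuter.mono (sampleAlgebra_mono e2))).const_smul _)).add
    ((h1.xlow.mono (sampleAlgebra_mono e1)).const_smul _)).const_smul _)

variable [IsProbabilityMeasure prob]

theorem phaseAdapted_zero
    (hrun : ∀ ω, IsRun P M a (fun k => O.miniBatch (a.c k) (fun j => ξ k j ω)) x0 xlow0 (I ω)) :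
    PhaseAdapted a x0 prob ξ I 0 where
  xlow := by
    simp only [fun ω => (hrun ω).xlow_zero]
    exact .const _
  zOuter := .const _
  xOuter := .const _
  xHat := .const _
  x h := by omega

theorem inner_adapted (ha : a.Admissible) (hη : ∀ k, 1 ≤ k → k ≤ a.N → ∀ t, 1 ≤ t → t ≤ a.T k →
      0 ≤ a.η k t)
    (hrun : ∀ ω, IsRun P M a (fun k => O.miniBatch (a.c k) (fun j => ξ k j ω)) x0 xlow0 (I ω))
    {k : ℕ} (hk : 1 ≤ k) (hkN : k ≤ a.N) (ih : ∀ l < k, PhaseAdapted a x0 prob ξ I l)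
    (hv : SqAdapted (sampleAlgebra ξ {s | s.1 < k + 1}) prob
      fun ω => O.miniBatch (a.c k) (fun j => ξ k j ω) ((I ω).xlow k)) (t : ℕ) (htT : t ≤ a.T k) :
    SqAdapted (sampleAlgebra ξ {s | s.1 < k + 1}) prob (fun ω => (I ω).x k t) ∧
      SqAdapted (sampleAlgebra ξ {s | s.1 < k + 1}) prob (fun ω => (I ω).z k t) := by
  have e1 : k - 1 + 1 ≤ k + 1 := by omega
  have hO := (ih (k - 1) (by omega)).xOuter.mono (sampleAlgebra_mono (ξ := ξ) e1)
  induction t using Nat.strong_induction_on with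
  | _ t iht =>
  rcases Nat.eq_zero_or_pos t with rfl | ht
  · simp only [fun ω => (hrun ω).x_start k hk hkN, fun ω => (hrun ω).z_start k hk hkN]
    exact ⟨hO, (ih (k - 1) (by omega)).zOuter.mono (sampleAlgebra_mono e1)⟩
  have hprev := iht (t - 1) (by omega) (by omega)
  have hlag : SqAdapted (sampleAlgebra ξ {s | s.1 < k + 1}) prob
      (fun ω => (I ω).xLag a x0 k t) := by
    simp only [Iterates.xLag]
    split_ifs with h1 h2
    · exact .const _
    · exact ((ih (k - 1) (by omega)).x (by omega) _ (by omega)).mono (sampleAlgebra_mono e1)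
    · exact (iht (t - 2) (by omega) (by omega)).1
  have hz : SqAdapted (sampleAlgebra ξ {s | s.1 < k + 1}) prob (fun ω => (I ω).z k t) := by
    simp only [fun ω => (hrun ω).dual_step ha hk hkN ht htT, Iterates.uTilde]
    exact hprev.2.add (((hprev.1.add ((hprev.1.sub hlag).const_smul _)).clm
      (blockOp d M)).const_smul _)
  refine ⟨?_, hz⟩
  have hp := ha.p_pos k hk hkN
  have hh := ((hv.add (hz.clm (blockOp d M.transpose))).sub (hprev.1.const_smul (a.η k t))).sub
    (hO.const_smul (a.p k))
  -- Two outcomes give two runs, and prox stability compares their primal iterates through the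
  -- combined linear data `hh`.
  exact hh.of_norm_sub_le ⟨(a.p k)⁻¹, by positivity⟩ fun ω ω' =>
    (hrun ω).norm_x_sub_le (hrun ω') hk hkN ht htT (hη k hk hkN t ht htT) hp

theorem phaseAdapted (ha : a.Admissible) (hη : ∀ k, 1 ≤ k → k ≤ a.N → ∀ t, 1 ≤ t → t ≤ a.T k →
      0 ≤ a.η k t) (hξ : IsSampling O prob ξ)
    (hrun : ∀ ω, IsRun P M a (fun k => O.miniBatch (a.c k) (fun j => ξ k j ω)) x0 xlow0 (I ω))
    (hquery : ∀ᵐ ω ∂prob, ∀ k, 1 ≤ k → k ≤ a.N → ∀ i, (I ω).xlow k i ∈ O.queryDomain i)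
    (k : ℕ) (hkN : k ≤ a.N) : PhaseAdapted a x0 prob ξ I k := by
  induction k using Nat.strong_induction_on with
  | _ k ihk =>
  rcases Nat.eq_zero_or_pos k with rfl | hk
  · exact phaseAdapted_zero hrun
  have ih : ∀ l < k, PhaseAdapted a x0 prob ξ I l := fun l hl => ihk l hl (by omega)
  have hlow := xlow_adapted hrun hk hkN ih
  have hin := inner_adapted ha hη hrun hk hkN ih (hξ.sqAdapted_miniBatch
    (ha.one_le_c k hk hkN) hlow (hquery.mono fun ω h => h k hk hkN))
  refine ⟨hlow.mono (sampleAlgebra_mono k.le_succ), ?_, ?_, ?_, fun _ t ht => (hin t ht).1⟩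
  · simp only [Iterates.zOuter, if_neg hk.ne']
    exact (hin _ le_rfl).2
  · simp only [Iterates.xOuter, if_neg hk.ne']
    exact (hin _ le_rfl).1
  · simp only [Iterates.xHat, if_neg hk.ne']
    exact (SqAdapted.sum _ fun t ht => (hin t (Finset.mem_Icc.1 ht).2).1).const_smul _

end Adapted

namespace LocalData

variable {V : Type*} {d : ℕ} (P : LocalData V d)

theorem measurable_ν_comp {Ω : Type*} [MeasurableSpace Ω] (i : V)
    {y : Ω → EuclideanSpace ℝ (Fin d)} (hy : Measurable y) (hmem : ∀ ω, y ω ∈ P.X i) :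
    Measurable fun ω => P.ν i (y ω) := by
  have h1 : LowerSemicontinuous ((P.X i).domRestrict (P.ν i)) :=
    lowerSemicontinuous_restrict_iff.2 (P.lowerSemicontinuousOn_ν i)
  exact h1.measurable.comp (hy.subtype_mk (h := hmem))

theorem measurable_objective_comp [Fintype V] {Ω : Type*} [MeasurableSpace Ω] {y : Ω → Stack V d}
    (hy : Measurable y) (hmem : ∀ ω, y ω ∈ P.feasible) :
    Measurable fun ω => P.objective (y ω) := by
  refine Finset.measurable_sum _ fun i _ => ?_
  have hi : Measurable fun ω => y ω i := (measurable_stack_apply i).comp hy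
  exact ((P.differentiable_fs i).continuous.measurable.comp hi).add
    ((P.measurable_ν_comp i hi fun ω => hmem ω i).const_mul _)

end LocalData

/-! ### Consequences of the saddle point property -/

section Saddle

variable {V κ : Type*} [Fintype V] [Fintype κ] {d : ℕ} {P : LocalData V d} {M : Matrix κ V ℝ}
  {xs : Stack V d} {zs : Stack κ d}

/-- Moving the multiplier from `zs` to `zs + A xs` raises the Lagrangian by `‖A xs‖²`, while `zs` is
maximal. -/
theorem blockOp_eq_zero_of_saddle (hxs : xs ∈ P.feasible)
    (h : IsSaddlePointOn P.feasible Set.univ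
      (fun x z => P.objective x + inner ℝ (blockOp d M x) z) xs zs) : blockOp d M xs = 0 := by
  have h1 := h xs hxs (zs + blockOp d M xs) (Set.mem_univ _)
  simp only [inner_add_right, real_inner_self_eq_norm_sq] at h1
  exact norm_eq_zero.1 (pow_eq_zero_iff two_ne_zero |>.1
    (le_antisymm (by linarith) (sq_nonneg _)))

theorem neg_mul_norm_le_of_saddle
    (h : IsSaddlePointOn P.feasible Set.univ
      (fun x z => P.objective x + inner ℝ (blockOp d M x) z) xs zs) {x : Stack V d}
    (hx : x ∈ P.feasible) :
    -(‖zs‖ * ‖blockOp d M x‖) ≤ P.objective x - P.objective xs := by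
  have h1 := h x hx 0 (Set.mem_univ _)
  have h2 := real_inner_le_norm (blockOp d M x) zs
  simp only [inner_zero_right] at h1
  linarith

end Saddle

theorem exists_norm_le_inner_eq {F : Type*} [NormedAddCommGroup F] [InnerProductSpace ℝ F]
    (y : F) {ρ : ℝ} (hρ : 0 ≤ ρ) : ∃ z : F, ‖z‖ ≤ ρ ∧ inner ℝ y z = ρ * ‖y‖ := by
  rcases eq_or_ne y 0 with rfl | hy
  · exact ⟨0, by simpa using hρ, by simp⟩
  have hy' := norm_pos_iff.2 hy
  refine ⟨(ρ / ‖y‖) • y, ?_, ?_⟩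
  · rw [norm_smul, Real.norm_of_nonneg (by positivity), div_mul_cancel₀ _ hy'.ne']
  · rw [real_inner_smul_right, real_inner_self_eq_norm_sq]
    field_simp

/-! ### Passing to expectations -/

section Expectation

variable {V κ : Type*} {d : ℕ} [Fintype V] [Fintype κ] {P : LocalData V d} {M : Matrix κ V ℝ}
  {a : Params} {x0 xlow0 : Stack V d} {Ξ : V → Type*} [∀ i, MeasurableSpace (Ξ i)] {σ : ℝ}
  {O : Oracle P Ξ σ} {Ω : Type*} {mΩ : MeasurableSpace Ω} {prob : Measure Ω}
  {ξ : ℕ → ℕ → Ω → ∀ i, Ξ i} {I : Ω → Iterates V κ d}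

theorem measurable_output (hξ : IsSampling O prob ξ)
    (hA : ∀ k ≤ a.N, PhaseAdapted a x0 prob ξ I k) :
    Measurable fun ω => (I ω).output a x0 := by
  have h : ∀ k ∈ Finset.Icc 1 a.N, Measurable fun ω => a.β k • (I ω).xHat a x0 k := fun k hk =>
    ((hA k (Finset.mem_Icc.1 hk).2).xHat.1.mono (hξ.sampleAlgebra_le _) le_rfl).const_smul (a.β k)
  exact (Finset.measurable_sum _ h).const_smul (∑ k ∈ Finset.Icc 1 a.N, a.β k)⁻¹

variable [IsProbabilityMeasure prob]

theorem integral_error_terms (ha : a.Admissible) (hξ : IsSampling O prob ξ)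
    (hrun : ∀ ω, IsRun P M a (fun k => O.miniBatch (a.c k) (fun j => ξ k j ω)) x0 xlow0 (I ω))
    (hquery : ∀ᵐ ω ∂prob, ∀ k, 1 ≤ k → k ≤ a.N → ∀ i, (I ω).xlow k i ∈ O.queryDomain i)
    (hA : ∀ k ≤ a.N, PhaseAdapted a x0 prob ξ I k) (u : Stack V d) {k : ℕ} (hk : 1 ≤ k)
    (hkN : k ≤ a.N) :
    Integrable (fun ω => a.β k *
      (‖O.miniBatch (a.c k) (fun j => ξ k j ω) ((I ω).xlow k) - P.grad ((I ω).xlow k)‖ ^ 2 / a.p k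
        + inner ℝ (O.miniBatch (a.c k) (fun j => ξ k j ω) ((I ω).xlow k) - P.grad ((I ω).xlow k))
          (u - (I ω).xOuter a x0 (k - 1)))) prob ∧
    ∫ ω, a.β k *
      (‖O.miniBatch (a.c k) (fun j => ξ k j ω) ((I ω).xlow k) - P.grad ((I ω).xlow k)‖ ^ 2 / a.p k
        + inner ℝ (O.miniBatch (a.c k) (fun j => ξ k j ω) ((I ω).xlow k) - P.grad ((I ω).xlow k))
          (u - (I ω).xOuter a x0 (k - 1))) ∂prob ≤ a.β k * σ ^ 2 / (a.p k * a.c k) := by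
  have hβ := ha.β_pos k hk hkN
  have hp := ha.p_pos k hk hkN
  have hc := ha.one_le_c k hk hkN
  have hc' : (0 : ℝ) < a.c k := by positivity
  have hlow := xlow_adapted hrun hk hkN fun l hl => hA l (by omega)
  have hdom := hquery.mono fun ω h => h k hk hkN
  have hW : SqAdapted (sampleAlgebra ξ {s | s.1 < k}) prob
      fun ω => u - (I ω).xOuter a x0 (k - 1) :=
    (SqAdapted.const u).sub ((hA (k - 1) (by omega)).xOuter.mono (sampleAlgebra_mono (by omega)))
  have h1 := hξ.miniBatch_error hc hlow.1 hdom
  have h2 := hξ.integral_inner_miniBatch_error hc hlow.1 hdom hW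
  have i1 := h1.1.integrable_norm_sq.div_const (a.p k)
  have i2 := h1.1.2.integrable_real_inner hW.2
  refine ⟨(i1.add i2).const_mul _, ?_⟩
  rw [integral_const_mul, integral_add i1 i2, h2, integral_div, add_zero]
  calc _ ≤ a.β k * (σ ^ 2 / a.c k / a.p k) := by
        gcongr
        exact h1.2
    _ = _ := by field_simp

theorem expectation_bounds (xs : Stack V d) (zs : Stack κ d) (hxs : xs ∈ P.feasible)
    (hsaddle : IsSaddlePointOn P.feasible Set.univ
      (fun x z => P.objective x + inner ℝ (blockOp d M x) z) xs zs)
    (ha : a.Admissible) (hcond : a.Conditions P.μ P.L ‖blockOp d M‖) (hξ : IsSampling O prob ξ)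
    (hrun : ∀ ω, IsRun P M a (fun k => O.miniBatch (a.c k) (fun j => ξ k j ω)) x0 xlow0 (I ω))
    (hquery : ∀ᵐ ω ∂prob, ∀ k, 1 ≤ k → k ≤ a.N → ∀ i, (I ω).xlow k i ∈ O.queryDomain i) :
    (Integrable (fun ω => P.objective ((I ω).output a x0) - P.objective xs) prob ∧
      ∫ ω, (P.objective ((I ω).output a x0) - P.objective xs) ∂prob ≤
        (∑ k ∈ Finset.Icc 1 a.N, a.β k)⁻¹ *
          (a.β 1 / 2 * (a.η 1 1 / a.T 1 + a.p 1) * ‖x0 - xs‖ ^ 2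
            + ∑ k ∈ Finset.Icc 1 a.N, a.β k * σ ^ 2 / (a.p k * a.c k))) ∧
    (Integrable (fun ω => ‖blockOp d M ((I ω).output a x0)‖) prob ∧
      ∫ ω, ‖blockOp d M ((I ω).output a x0)‖ ∂prob ≤
        (∑ k ∈ Finset.Icc 1 a.N, a.β k)⁻¹ *
          (a.β 1 * a.q 1 1 / (2 * a.T 1) * (‖zs‖ + 1) ^ 2
            + a.β 1 / 2 * (a.η 1 1 / a.T 1 + a.p 1) * ‖x0 - xs‖ ^ 2
            + ∑ k ∈ Finset.Icc 1 a.N, a.β k * σ ^ 2 / (a.p k * a.c k))) := by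
  have hη : ∀ k, 1 ≤ k → k ≤ a.N → ∀ t, 1 ≤ t → t ≤ a.T k → 0 ≤ a.η k t :=
    fun k hk hkN t ht htT => hcond.η_nonneg ha hk hkN ht htT
  have hA := phaseAdapted ha hη hξ hrun hquery
  have hAxs := blockOp_eq_zero_of_saddle hxs hsaddle
  have hout := measurable_output hξ hA
  have hmem : ∀ ω, (I ω).output a x0 ∈ P.feasible := fun ω => (hrun ω).output_mem ha
  have hB : 0 < ∑ k ∈ Finset.Icc 1 a.N, a.β k :=
    Finset.sum_pos (fun k hk => ha.β_pos k (Finset.mem_Icc.1 hk).1 (Finset.mem_Icc.1 hk).2)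
      ⟨1, Finset.mem_Icc.2 ⟨le_rfl, ha.one_le_N⟩⟩
  set B := ∑ k ∈ Finset.Icc 1 a.N, a.β k
  have hq : 0 ≤ a.β 1 * a.q 1 1 / (2 * a.T 1) := by
    have h1 := ha.β_pos 1 le_rfl ha.one_le_N
    have h2 := ha.q_pos 1 le_rfl ha.one_le_N 1 le_rfl (ha.one_le_T 1 le_rfl ha.one_le_N)
    positivity
  set c₁ := a.β 1 * a.q 1 1 / (2 * a.T 1)
  set c₂ := a.β 1 / 2 * (a.η 1 1 / a.T 1 + a.p 1) * ‖x0 - xs‖ ^ 2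
  let R : Ω → ℝ := fun ω => ∑ k ∈ Finset.Icc 1 a.N, a.β k *
      (‖O.miniBatch (a.c k) (fun j => ξ k j ω) ((I ω).xlow k) - P.grad ((I ω).xlow k)‖ ^ 2 / a.p k
        + inner ℝ (O.miniBatch (a.c k) (fun j => ξ k j ω) ((I ω).xlow k) - P.grad ((I ω).xlow k))
          (xs - (I ω).xOuter a x0 (k - 1)))
  have hterm := fun k hk => integral_error_terms ha hξ hrun hquery hA xs (k := k)
    (Finset.mem_Icc.1 hk).1 (Finset.mem_Icc.1 hk).2
  have hRint : Integrable R prob := integrable_finsetSum _ fun k hk => (hterm k hk).1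
  have hRle : ∫ ω, R ω ∂prob ≤ ∑ k ∈ Finset.Icc 1 a.N, a.β k * σ ^ 2 / (a.p k * a.c k) := by
    refine (integral_finsetSum _ fun k hk => (hterm k hk).1).trans_le ?_
    exact Finset.sum_le_sum fun k hk => (hterm k hk).2
  have hgap : ∀ ω z, P.objective ((I ω).output a x0) - P.objective xs
      + inner ℝ (blockOp d M ((I ω).output a x0)) z ≤ B⁻¹ * (c₁ * ‖z‖ ^ 2 + c₂ + R ω) := by
    intro ω z
    rw [le_inv_mul_iff₀ hB]
    exact (hrun ω).gap_bound ha hcond hxs hAxs z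
  have hf : ∀ ω, P.objective ((I ω).output a x0) - P.objective xs ≤ B⁻¹ * (c₂ + R ω) := by
    intro ω
    simpa using hgap ω 0
  have hr : ∀ ω, ‖blockOp d M ((I ω).output a x0)‖ ≤
      B⁻¹ * (c₁ * (‖zs‖ + 1) ^ 2 + c₂ + R ω) := by
    intro ω
    -- This `z` varies with `ω`, but needs no measurability: it enters the bound only through `‖z‖ ≤
    -- ‖zs‖ + 1`.
    obtain ⟨z, hz, hz'⟩ := exists_norm_le_inner_eq (blockOp d M ((I ω).output a x0))
      (add_nonneg (norm_nonneg zs) zero_le_one)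
    have h1 := hgap ω z
    have h2 := neg_mul_norm_le_of_saddle hsaddle (hmem ω)
    have h3 : B⁻¹ * (c₁ * ‖z‖ ^ 2 + c₂ + R ω) ≤ B⁻¹ * (c₁ * (‖zs‖ + 1) ^ 2 + c₂ + R ω) := by
      gcongr
    rw [hz'] at h1
    linarith
  have hint₁ : Integrable (fun ω => B⁻¹ * (c₂ + R ω)) prob :=
    ((integrable_const _).add hRint).const_mul _
  have hint₂ : Integrable (fun ω => B⁻¹ * (c₁ * (‖zs‖ + 1) ^ 2 + c₂ + R ω)) prob :=
    ((integrable_const _).add hRint).const_mul _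
  have hrint : Integrable (fun ω => ‖blockOp d M ((I ω).output a x0)‖) prob := by
    refine hint₂.mono' ((blockOp d M).continuous.measurable.comp hout).norm.aestronglyMeasurable ?_
    filter_upwards with ω
    rw [norm_norm]
    exact hr ω
  have hfint : Integrable (fun ω => P.objective ((I ω).output a x0) - P.objective xs) prob := by
    -- The objective gap lies between a multiple of the integrable residual and the integrable upper
    -- bound. Its measurability rests on lower semicontinuity of `ν i` on `X i`, where the output
    -- stays.
    refine integrable_of_le_of_le
      ((P.measurable_objective_comp hout hmem).sub_const _).aestronglyMeasurable
      (by filter_upwards with ω using neg_mul_norm_le_of_saddle hsaddle (hmem ω))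
      (by filter_upwards with ω using hf ω) (hrint.const_mul _).neg hint₁
  refine ⟨⟨hfint, (integral_mono hfint hint₁ hf).trans ?_⟩,
    hrint, (integral_mono hrint hint₂ hr).trans ?_⟩ <;>
  · rw [integral_const_mul, integral_add (integrable_const _) hRint, integral_const, probReal_univ,
      one_smul]
    gcongr

end Expectation

end

end SPDS

theorem proposition3p1 {V κ : Type*} [Fintype V] [Fintype κ] {d : ℕ}
    (Gr : SimpleGraph V) (_hGr : Gr.Connected)
    (M : Matrix κ V ℝ) (_hM : SPDS.EnforcesConsensus Gr M)
    (P : SPDS.LocalData V d)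
    {Ξ : V → Type*} [∀ i, MeasurableSpace (Ξ i)] (σ : ℝ) (O : SPDS.Oracle P Ξ σ)
    (xs : SPDS.Stack V d) (zs : SPDS.Stack κ d)
    (hxs : xs ∈ P.feasible)
    (hsaddle : IsSaddlePointOn P.feasible Set.univ
      (fun x z => P.objective x + inner ℝ (SPDS.blockOp d M x) z) xs zs)
    (a : SPDS.Params) (ha : a.Admissible)
    (hcond : a.Conditions P.μ P.L ‖SPDS.blockOp d M‖)
    {Ω : Type*} [MeasurableSpace Ω] (prob : Measure Ω) [IsProbabilityMeasure prob]
    (ξ : ℕ → ℕ → Ω → ∀ i, Ξ i) (hξ : SPDS.IsSampling O prob ξ)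
    (x0 xlow0 : SPDS.Stack V d) (hx0 : x0 ∈ P.feasible) (hxlow0 : xlow0 ∈ P.feasible)
    (I : Ω → SPDS.Iterates V κ d)
    (hrun : ∀ ω, SPDS.IsRun P M a (fun k => O.miniBatch (a.c k) (fun j => ξ k j ω)) x0 xlow0 (I ω))
    (hquery : ∀ᵐ ω ∂prob, ∀ k, 1 ≤ k → k ≤ a.N → ∀ i, (I ω).xlow k i ∈ O.queryDomain i) :
    (Integrable (fun ω => P.objective ((I ω).output a x0) - P.objective xs) prob ∧
      ∫ ω, (P.objective ((I ω).output a x0) - P.objective xs) ∂prob ≤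
        (∑ k ∈ Finset.Icc 1 a.N, a.β k)⁻¹ *
          (a.β 1 / 2 * (a.η 1 1 / a.T 1 + a.p 1) * ‖x0 - xs‖ ^ 2
            + ∑ k ∈ Finset.Icc 1 a.N, a.β k * σ ^ 2 / (a.p k * a.c k))) ∧
    (Integrable (fun ω => ‖SPDS.blockOp d M ((I ω).output a x0)‖) prob ∧
      ∫ ω, ‖SPDS.blockOp d M ((I ω).output a x0)‖ ∂prob ≤
        (∑ k ∈ Finset.Icc 1 a.N, a.β k)⁻¹ *
          (a.β 1 * a.q 1 1 / (2 * a.T 1) * (‖zs‖ + 1) ^ 2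
            + a.β 1 / 2 * (a.η 1 1 / a.T 1 + a.p 1) * ‖x0 - xs‖ ^ 2
            + ∑ k ∈ Finset.Icc 1 a.N, a.β k * σ ^ 2 / (a.p k * a.c k))) :=
  SPDS.expectation_bounds xs zs hxs hsaddle ha hcond hξ hrun hquery
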